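/- Conventions. Let $(R,\mathfrak m)$ be a regular local domain with $\dim R\ge 2$ and fraction field $K$. Models over $R$ are taken in the sense of Zariski and Samuel: a model is a set of local subrings of $K$ containing $R$ which is a finite union of affine models $\{A_P : P\in\operatorname{Spec}A\}$ of finitely generated $R$-subalgebras $A\subseteq K$ and is such that each valuation ring of $K$ containing $R$ dominates at most one of its members; it is complete if each such valuation ring dominates exactly one member, and normal if all its members are integrally closed. A morphism of models $X\to Y$ exists if each $T\in X$ dominates some (necessarily unique) $S\in Y$, and then sends $T$ to $S$; it is biregular at $S\in Y$ if its fibre over $S$ is $\{S\}$. A local quadratic transform of a local ring $(S,\mathfrak m_S)$ is a local ring on $\operatorname{Proj}S[\mathfrak m_S t]$ that dominates $S$. A regular local ring $S$ dominating $R$ is infinitely near to $R$ if $\dim S\ge 2$ and $S$ is obtained from $R$ by a finite (possibly empty) sequence of local quadratic transforms. It is a base point of an ideal $I$ of $R$ of height at least $2$ if the transform $I^S=a^{-1}IS$ is a proper ideal of $S$, where $aS$ is the smallest principal ideal of $S$ containing $IS$. The ideal $I$ is finitely supported if its set $\mathcal{BP}(I)$ of base points is finite; in that case, for $\Gamma=\mathcal{BP}(I)$,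 $X_\Gamma$ denotes the regular model obtained from $\operatorname{Spec}R$ by successively blowing up the maximal ideals of the points of $\Gamma$. For a regular local ring $S$ with fraction field $K$, $\operatorname{ord}_S$ denotes the discrete valuation (ring) of $K$ given by the powers of $\mathfrak m_S$. The set $\operatorname{Rees}I$ of Rees valuation rings of $I$ is the unique minimal finite set of discrete valuation rings $V$ with $R\subseteq V\subseteq K$ such that $\overline{I^n}=\bigcap_V I^nV\cap R$ for all $n$. Finally, $\overline{R[It]}$ is the integral closure of the Rees algebra $R[It]$, and an overring $B\subseteq K$ of a domain $A$ with fraction field $K$ is a sublocalization of $A$ if it is an intersection of localizations of $A$ at multiplicatively closed sets of nonzero elements. Theorem 3.10. Let $(R,\mathfrak m)$ be a regular local domain with $\dim R\ge 2$, let $I$ be a finitely supported $\mathfrak m$-primary ideal of $R$, and let $\Gamma=\mathcal{BP}(I)$. Let $Y$ be a normal complete model over $R$ such that there are morphisms of models $g:X_\Gamma\to Y$ and $h:Y\to\operatorname{Proj}\overline{R[It]}$ (so that $h\circ g$ is the morphism $f:X_\Gamma\to\operatorname{Proj}\overline{R[It]}$). If $\operatorname{ord}_{R_i}\in\operatorname{Rees}I$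 for each $R_i\in\Gamma$, then: 1. For each $S\in Y$ and each $T\in g^{-1}(S)$, the ring $T$ is a sublocalization of $S$. 2. The morphism $g:X_\Gamma\to Y$ is biregular at each $S\in Y$ that has torsion divisor class group. 3. If $S\in Y$ is not regular, then the divisor class group of $S$ is not a torsion group. -/

import Mathlib

open IsLocalRing

namespace ZariskiModel

/-! ### Models

A model over a subring `R` of a field `K` is a set of local subrings of `K`, in the sense of
Zariski and Samuel.  The order `S ≤ T` on `LocalSubring K` is domination: `S ⊆ T` and
`𝔪_T ∩ S = 𝔪_S`. -/

section Models

variable {K : Type*} [Field K]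

/-- The affine model of a subring `A` of `K`: all local rings `A_P`, for `P` a prime of `A`. -/
def affineModel (A : Subring K) : Set (LocalSubring K) :=
  {S | ∃ (P : Ideal A) (_ : P.IsPrime), S = LocalSubring.ofPrime A P}

/-- `M` is a model over `R`: a finite union of affine models of finitely generated
`R`-subalgebras of `K`, such that each valuation ring of `K` containing `R` dominates at most one
member of `M` (irredundance). -/
structure IsModel (R : Subring K) (M : Set (LocalSubring K)) : Prop where
  finite_union : ∃ F : Set (Subalgebra R K), F.Finite ∧ (∀ A ∈ F, A.FG) ∧
    M = ⋃ A ∈ F, affineModel A.toSubring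
  irredundant : ∀ V : ValuationSubring K, R ≤ V.toSubring →
    ∀ S ∈ M, ∀ T ∈ M, S ≤ V.toLocalSubring → T ≤ V.toLocalSubring → S = T

/-- A model is complete if each valuation ring of `K` containing `R` dominates a member of it. -/
structure IsCompleteModel (R : Subring K) (M : Set (LocalSubring K)) : Prop
    extends IsModel R M where
  complete : ∀ V : ValuationSubring K, R ≤ V.toSubring → ∃ S ∈ M, S ≤ V.toLocalSubring

/-- A model is normal if all its local rings are integrally closed. -/
def IsNormalModel (M : Set (LocalSubring K)) : Prop :=
  ∀ S ∈ M, IsIntegrallyClosed S.toSubring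

/-- There is a (birational) morphism of models `X → Y`: each `T ∈ X` dominates some `S ∈ Y`, its
image.  By irredundance of `Y` the image is unique. -/
def HasMorphism (X Y : Set (LocalSubring K)) : Prop :=
  ∀ T ∈ X, ∃ S ∈ Y, S ≤ T

/-- The fibre over `S` of the morphism from `X` to a model containing `S`. -/
def fiber (X : Set (LocalSubring K)) (S : LocalSubring K) : Set (LocalSubring K) :=
  {T | T ∈ X ∧ S ≤ T}

/-- The morphism from `X` to a model containing `S` is biregular at `S`. -/
def IsBiregularAt (X : Set (LocalSubring K)) (S : LocalSubring K) : Prop :=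
  fiber X S = {S}

/-! ### Blowups -/

/-- The chart `R[I/a]` of the blowup of `I`. -/
noncomputable def blowupChart (R : Subring K) (I : Ideal R) (a : R) : Subring K :=
  (Algebra.adjoin R {x : K | ∃ b ∈ I, x = (b : K) / (a : K)}).toSubring

/-- The blowup `Proj R[It]` of `I`, as a set of local rings. -/
def blowup (R : Subring K) (I : Ideal R) : Set (LocalSubring K) :=
  {S | ∃ a ∈ I, a ≠ 0 ∧ S ∈ affineModel (blowupChart R I a)}

/-- The normalized blowup, i.e. `Proj` of the integral closure of the Rees algebra `R[It]`, as a
set of local rings: its charts are the integral closures in `K` of the rings `R[I/a]`. -/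
def normalizedBlowup (R : Subring K) (I : Ideal R) : Set (LocalSubring K) :=
  {S | ∃ a ∈ I, a ≠ 0 ∧
    S ∈ affineModel (integralClosure (blowupChart R I a) K).toSubring}

/-! ### Infinitely near points, base points and the saturated regular model -/

/-- `T` is a local quadratic transform of `S`: a local ring on the blowup of the maximal ideal of
`S` that dominates `S`. -/
def IsLocalQuadraticTransform (S T : LocalSubring K) : Prop :=
  T ∈ blowup S.toSubring (maximalIdeal S.toSubring) ∧ S ≤ T

/-- `S` is infinitely near to `R`: it is a regular local ring of dimension at least two that
dominates `R` and is obtained from `R` by a finite (possibly empty) sequence of local quadratic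
transforms. -/
structure IsInfinitelyNear (R S : LocalSubring K) : Prop where
  regular : IsRegularLocalRing S.toSubring
  two_le_dim : 2 ≤ ringKrullDim S.toSubring
  dominates : R ≤ S
  chain : Relation.ReflTransGen IsLocalQuadraticTransform R S

/-- The extension `IS` of an ideal `I` of `R` to a larger subring `S` of `K`. -/
def extendIdeal {R : Subring K} (I : Ideal R) (S : Subring K) : Ideal S :=
  Ideal.span {s : S | ∃ r ∈ I, (r : K) = (s : K)}

/-- `aA` is the smallest principal ideal of `A` containing `J`. -/
def IsSmallestPrincipal {A : Type*} [CommRing A] (J : Ideal A) (a : A) : Prop :=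
  J ≤ Ideal.span {a} ∧ ∀ b : A, J ≤ Ideal.span {b} → Ideal.span {a} ≤ Ideal.span {b}

/-- The transform `a⁻¹ (IS)` of `I` in the unique factorization domain `S`, where `aS` is the
smallest principal ideal of `S` containing `IS`. -/
def idealTransform {R : Subring K} (I : Ideal R) (S : Subring K) : Ideal S :=
  Ideal.span {x : S | ∃ a : S, IsSmallestPrincipal (extendIdeal I S) a ∧
    a * x ∈ extendIdeal I S}

/-- The set of base points of `I`: the points infinitely near to `R` in which the transform of
`I` is a proper ideal. -/
def basePoints (R : LocalSubring K) (I : Ideal R.toSubring) : Set (LocalSubring K) :=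
  {S | IsInfinitelyNear R S ∧ idealTransform I S.toSubring ≠ ⊤}

/-- Blow up (the maximal ideals of) the points of `X` that belong to `Γ`: such a point is replaced
by its local quadratic transforms, and the other points of `X` are kept. -/
def blowupPoints (Γ X : Set (LocalSubring K)) : Set (LocalSubring K) :=
  {T | (T ∈ X ∧ T ∉ Γ) ∨ ∃ S ∈ X, S ∈ Γ ∧ IsLocalQuadraticTransform S T}

/-- The saturated regular model `X_Γ`: start from `Spec R` and successively blow up the points of
`Γ`.  For the finite set `Γ` of base points of a finitely supported ideal this sequence of models
becomes constant, and `X_Γ` is its eventual value. -/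
def saturatedModel (R : LocalSubring K) (Γ : Set (LocalSubring K)) : Set (LocalSubring K) :=
  {T | ∃ N : ℕ, ∀ n ≥ N, T ∈ (blowupPoints Γ)^[n] (affineModel R.toSubring)}

/-! ### Order valuations and Rees valuations -/

/-- The underlying set of the valuation ring of `ord_S`: the fractions `f / g` of elements of `S`
with `ord_S g ≤ ord_S f`, where `ord_S` is the order function of the powers of `𝔪_S`. -/
def ordRing (S : LocalSubring K) : Set K :=
  {x | ∃ f g : S.toSubring, g ≠ 0 ∧ x = (f : K) / (g : K) ∧
    ∀ n : ℕ, g ∈ maximalIdeal S.toSubring ^ n → f ∈ maximalIdeal S.toSubring ^ n}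

/-- `x` belongs to the integral closure of the ideal `J`. -/
def IsIntegralOverIdeal {A : Type*} [CommRing A] (J : Ideal A) (x : A) : Prop :=
  ∃ n : ℕ, 0 < n ∧ ∃ c : ℕ → A, (∀ i ∈ Finset.Icc 1 n, c i ∈ J ^ i) ∧
    x ^ n + ∑ i ∈ Finset.Icc 1 n, c i * x ^ (n - i) = 0

/-- `F` is a finite set of discrete valuation rings `V` with `R ⊆ V ⊆ K` such that, for all `n`,
the integral closure of `Iⁿ` is the intersection of the ideals `IⁿV ∩ R`. -/
structure DeterminesIntegralClosures (R : Subring K) (I : Ideal R)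
    (F : Set (ValuationSubring K)) : Prop where
  finite : F.Finite
  le : ∀ V ∈ F, R ≤ V.toSubring
  dvr : ∀ V ∈ F, IsDiscreteValuationRing V
  mem_iff : ∀ (n : ℕ) (x : R), IsIntegralOverIdeal (I ^ n) x ↔
    ∀ V ∈ F, ∃ y ∈ extendIdeal (I ^ n) V.toSubring, (y : K) = (x : K)

/-- The set `Rees I` of Rees valuation rings of `I`: the members of the (unique) minimal finite
set of discrete valuation rings that determines the integral closures of the powers of `I`. -/
def reesValuationRings (R : Subring K) (I : Ideal R) : Set (ValuationSubring K) :=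
  {V | ∃ F, Minimal (DeterminesIntegralClosures R I) F ∧ V ∈ F}

/-! ### Sublocalizations -/

/-- `B` is a sublocalization of `A`: an intersection of localizations of `A`. -/
def IsSublocalization (A B : Subring K) : Prop :=
  ∃ F : Set (Submonoid A), (∀ M ∈ F, (0 : A) ∉ M) ∧
    ∀ x : K, x ∈ B ↔ ∀ M ∈ F, ∃ a : A, ∃ s ∈ M, x = (a : K) / (s : K)

end Models

/-! ### The divisor class group of a normal Noetherian domain -/

section DivisorClassGroup

variable (A : Type*) [CommRing A]

/-- The height one primes of `A`. -/
def HeightOnePrime : Type _ := {P : PrimeSpectrum A // P.asIdeal.height = 1}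

variable {A}

/-- The order of `a ≠ 0` at the height one prime `P`: the largest `n` with `a ∈ Pⁿ A_P`. -/
noncomputable def ordAt (P : HeightOnePrime A) (a : A) : ℕ :=
  sSup {n : ℕ | algebraMap A (Localization.AtPrime P.1.asIdeal) a ∈
    maximalIdeal (Localization.AtPrime P.1.asIdeal) ^ n}

variable (A)

/-- The group of principal divisors `div (a / b)`, in the free abelian group on the height one
primes of `A`. -/
noncomputable def principalDivisors : AddSubgroup (HeightOnePrime A →₀ ℤ) :=
  AddSubgroup.closure {D | ∃ a b : A, a ≠ 0 ∧ b ≠ 0 ∧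
    ∀ P : HeightOnePrime A, D P = (ordAt P a : ℤ) - (ordAt P b : ℤ)}

/-- The divisor class group of `A`: divisors modulo principal divisors. -/
abbrev DivisorClassGroup : Type _ := (HeightOnePrime A →₀ ℤ) ⧸ principalDivisors A

/-- `A` has torsion divisor class group. -/
def HasTorsionDivisorClassGroup : Prop := IsAddTorsion (DivisorClassGroup A)

end DivisorClassGroup

end ZariskiModel

open ZariskiModel

/-! Write X for the saturated model. Its points are regular, hence normal, so each is the
intersection of the discrete valuation rings among its localizations. Blowing up a point S creates
just one new such ring, that of ord_S. Hence every discrete valuation localization W of a point T of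
X is either a localization of R or some ord_{R_i} (`eq_or_mem_affineModel_of_mem_iterate`).

By hypothesis the ord_{R_i} are Rees valuation rings, and these lie on every normal complete model
over the normalized blowup. Indeed, the discrete valuation rings on Y in which I is proper determine
the integral closures of the powers of I, and a minimal determining set is contained in any other
one (`subset_of_minimal`). So if T lies over S in Y, every W is a localization of S, and T is an
intersection of localizations of S.

If S has torsion class group, each height one prime P of S contains an element c lying in no other
height one prime. Were S_P missing among the rings W, then 1/c would lie in all of them, hence in T,
although c is a nonunit of S and T dominates S. So S and T are intersections of the same rings, and
T = S. Completeness of X makes the fibre nonempty. The last claim follows because the points of X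
are regular.

The commutative algebra behind this is Serre's theorem (localizations of regular local rings are
regular), normality of regular local rings, and regularity of blowups of closed points. -/

namespace ZariskiModel

/-! ### Regular local rings: parameters, quotients, integrality -/

section RegularLocal

open scoped Pointwise

variable {A : Type*} [CommRing A]

theorem isRegularLocalRing_of_span [IsLocalRing A] [IsNoetherianRing A] {n : ℕ} (y : Fin n → A)
    (hy : Ideal.span (Set.range y) = maximalIdeal A) (hn : (n : WithBot ℕ∞) ≤ ringKrullDim A) :
    IsRegularLocalRing A := by
  refine .of_spanFinrank_maximalIdeal_le A (le_trans ?_ hn)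
  rw [← hy]
  have h := Submodule.spanFinrank_span_le_ncard_of_finite (R := A) (Set.finite_range y)
  have h2 : (Set.range y).ncard ≤ n := by
    rw [← Set.image_univ]
    exact (Set.ncard_image_le Set.finite_univ).trans (by simp [Set.ncard_univ])
  exact_mod_cast h.trans h2

theorem ringKrullDim_le_of_span [IsLocalRing A] [IsNoetherianRing A] {n : ℕ} (y : Fin n → A)
    (hy : Ideal.span (Set.range y) = maximalIdeal A) : ringKrullDim A ≤ n := by
  refine (ringKrullDim_le_spanFinrank_maximalIdeal A).trans ?_
  rw [← hy]
  have h := Submodule.spanFinrank_span_le_ncard_of_finite (R := A) (Set.finite_range y)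
  have h2 : (Set.range y).ncard ≤ n := by
    rw [← Set.image_univ]
    exact (Set.ncard_image_le Set.finite_univ).trans (by simp [Set.ncard_univ])
  exact_mod_cast h.trans h2

theorem map_mk_maximalIdeal [IsLocalRing A] {J : Ideal A} [IsLocalRing (A ⧸ J)]
    (hJ : J ≤ maximalIdeal A) :
    (maximalIdeal A).map (Ideal.Quotient.mk J) = maximalIdeal (A ⧸ J) := by
  refine IsLocalRing.eq_maximalIdeal ?_
  refine (Ideal.map_eq_top_or_isMaximal_of_surjective _ Ideal.Quotient.mk_surjective
    inferInstance).resolve_left fun h => ?_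
  have h2 := congrArg (Ideal.comap (Ideal.Quotient.mk J)) h
  rw [Ideal.comap_map_of_surjective _ Ideal.Quotient.mk_surjective,
    ← RingHom.ker_eq_comap_bot, Ideal.mk_ker, sup_eq_left.mpr hJ, Ideal.comap_top] at h2
  exact Ideal.IsPrime.ne_top' h2

theorem exists_ringKrullDim_eq [IsLocalRing A] [IsNoetherianRing A] :
    ∃ n : ℕ, ringKrullDim A = n := by
  have h1 := ringKrullDim_le_spanFinrank_maximalIdeal A
  have h0 : (0 : WithBot ℕ∞) ≤ ringKrullDim A := ringKrullDim_nonneg_of_nontrivial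
  generalize ringKrullDim A = d at *
  induction d with
  | bot => simp at h0
  | coe d =>
    induction d with
    | top => exact absurd (WithBot.coe_le_coe.mp h1) (by simp)
    | coe n => exact ⟨n, rfl⟩

theorem exists_span_range_eq_maximalIdeal [IsRegularLocalRing A] {n : ℕ}
    (hn : ringKrullDim A = n) :
    ∃ y : Fin n → A, Ideal.span (Set.range y) = maximalIdeal A := by
  obtain ⟨s, hs, hs'⟩ :=
    Submodule.FG.exists_span_finset_card_eq_spanFinrank (IsNoetherian.noetherian (maximalIdeal A))
  have h : (Submodule.spanFinrank (maximalIdeal A)) = n := by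
    have := IsRegularLocalRing.spanFinrank_maximalIdeal (R := A)
    rw [hn] at this
    exact_mod_cast this
  let e := s.equivFinOfCardEq (hs.trans h)
  refine ⟨fun i => (e.symm i : A), ?_⟩
  rw [← hs']
  congr 1
  ext x
  constructor
  · rintro ⟨i, rfl⟩; exact (e.symm i).2
  · intro hx; exact ⟨e ⟨x, hx⟩, by simp⟩

/-- Lifted parameters of the quotient together with x generate the maximal ideal, and a
nonzerodivisor lowers the dimension by exactly one, so their number is right. -/
theorem isRegularLocalRing_of_quotient [IsLocalRing A] [IsNoetherianRing A] {x : A}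
    (hx : x ∈ nonZeroDivisors A) (hxm : x ∈ maximalIdeal A)
    [IsRegularLocalRing (A ⧸ Ideal.span {x})] : IsRegularLocalRing A := by
  obtain ⟨n, hn⟩ := exists_ringKrullDim_eq (A := A ⧸ Ideal.span {x})
  obtain ⟨y, hy⟩ := exists_span_range_eq_maximalIdeal hn
  have hd := ringKrullDim_quotient_span_singleton_succ_eq_ringKrullDim_of_mem_nonZeroDivisors hx hxm
  choose z hz using fun i => Ideal.Quotient.mk_surjective (y i)
  refine isRegularLocalRing_of_span (n := n + 1) (Fin.cons x z) ?_ ?_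
  · rw [Fin.range_cons, Ideal.span_insert]
    have h1 : (Ideal.span (Set.range z)).map (Ideal.Quotient.mk (Ideal.span {x}))
        = maximalIdeal _ := by
      rw [Ideal.map_span, ← hy, ← Set.range_comp]
      congr 2
      ext i; exact hz i
    have h2 := congrArg (Ideal.comap (Ideal.Quotient.mk (Ideal.span {x}))) h1
    rw [Ideal.comap_map_of_surjective _ Ideal.Quotient.mk_surjective, ← RingHom.ker_eq_comap_bot,
      Ideal.mk_ker, sup_comm] at h2
    rw [h2]
    have : ((maximalIdeal (A ⧸ Ideal.span {x})).comap
        (Ideal.Quotient.mk (Ideal.span {x}))).IsMaximal :=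
      Ideal.comap_isMaximal_of_surjective _ Ideal.Quotient.mk_surjective
    exact IsLocalRing.eq_maximalIdeal this
  · rw [← hd, hn]; simp

/-- Exchange argument: outside 𝔪², x has a unit coefficient on some parameter and can replace it. -/
theorem exists_span_insert_eq_maximalIdeal [IsRegularLocalRing A] {n : ℕ}
    (hn : ringKrullDim A = (n + 1 : ℕ)) {x : A} (hx : x ∈ maximalIdeal A)
    (hx2 : x ∉ maximalIdeal A ^ 2) :
    ∃ y : Fin n → A, Ideal.span (insert x (Set.range y)) = maximalIdeal A := by
  obtain ⟨z, hz⟩ := exists_span_range_eq_maximalIdeal hn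
  have hzm : ∀ i, z i ∈ maximalIdeal A := fun i => hz ▸ Ideal.subset_span ⟨i, rfl⟩
  rw [← hz, Ideal.mem_span_range_iff_exists_fun] at hx
  obtain ⟨c, hc⟩ := hx
  obtain ⟨i, hi⟩ : ∃ i, IsUnit (c i) := by
    by_contra! h
    apply hx2
    rw [← hc, pow_two]
    exact Ideal.sum_mem _ fun i _ => Ideal.mul_mem_mul (h i) (hzm i)
  refine ⟨fun j => z (i.succAbove j), le_antisymm ?_ ?_⟩
  · rw [Ideal.span_le, Set.insert_subset_iff]
    refine ⟨?_, ?_⟩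
    · rw [← hc]; exact Ideal.sum_mem _ fun i _ => Ideal.mul_mem_left _ _ (hzm i)
    · rintro _ ⟨j, rfl⟩; exact hzm _
  · rw [← hz, Ideal.span_le]
    have key : ∀ j, z (i.succAbove j) ∈
        Ideal.span (insert x (Set.range fun j => z (i.succAbove j))) := fun j =>
      Ideal.subset_span (Set.mem_insert_of_mem _ ⟨j, rfl⟩)
    rintro _ ⟨k, rfl⟩
    rcases Fin.eq_self_or_eq_succAbove i k with rfl | ⟨j, rfl⟩
    · rw [Fin.sum_univ_succAbove _ k] at hc
      have h1 : c k * z k ∈ Ideal.span (insert x (Set.range fun j => z (k.succAbove j))) := by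
        rw [← eq_sub_iff_add_eq] at hc
        rw [hc]
        refine Ideal.sub_mem _ (Ideal.subset_span (Set.mem_insert _ _)) ?_
        exact Ideal.sum_mem _ fun j _ => Ideal.mul_mem_left _ _ (key j)
      exact (Ideal.unit_mul_mem_iff_mem _ hi).mp h1
    · exact key j

/-- The n parameters that complete x generate the maximal ideal of the quotient, and killing one
element lowers the dimension by at most one. -/
theorem isRegularLocalRing_quotient [IsRegularLocalRing A] {n : ℕ}
    (hn : ringKrullDim A = (n + 1 : ℕ)) {x : A} (hx : x ∈ maximalIdeal A)
    (hx2 : x ∉ maximalIdeal A ^ 2) :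
    IsRegularLocalRing (A ⧸ Ideal.span {x}) ∧ ringKrullDim (A ⧸ Ideal.span {x}) = n := by
  obtain ⟨y, hy⟩ := exists_span_insert_eq_maximalIdeal hn hx hx2
  have hne : Ideal.span {x} ≠ ⊤ := by
    rw [Ne, Ideal.span_singleton_eq_top]; exact hx
  have := Ideal.Quotient.nontrivial_iff.mpr hne
  have : IsLocalRing (A ⧸ Ideal.span {x}) := .of_surjective' _ Ideal.Quotient.mk_surjective
  have hm : Ideal.span (Set.range fun i => Ideal.Quotient.mk (Ideal.span {x}) (y i)) =
      maximalIdeal (A ⧸ Ideal.span {x}) := by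
    rw [← map_mk_maximalIdeal ((Ideal.span_singleton_le_iff_mem _).mpr hx), ← hy,
      Ideal.map_span, Set.image_insert_eq, Ideal.span_insert,
      (Ideal.Quotient.eq_zero_iff_mem).mpr (Ideal.mem_span_singleton_self x), ← Set.range_comp]
    simp
    rfl
  have hdim : (n : WithBot ℕ∞) ≤ ringKrullDim (A ⧸ Ideal.span {x}) := by
    have := ringKrullDim_le_ringKrullDim_quotSMulTop_succ hx
    rw [hn] at this
    have h3 : x • (⊤ : Ideal A) = Ideal.span {x} := by
      simp [← Submodule.ideal_span_singleton_smul]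
    rw [ringKrullDim_eq_of_ringEquiv (Ideal.quotientEquivAlgOfEq A h3).toRingEquiv] at this
    obtain ⟨k, hk⟩ := exists_ringKrullDim_eq (A := A ⧸ Ideal.span {x})
    rw [hk] at this ⊢
    have h4 : n + 1 ≤ k + 1 := by exact_mod_cast this
    exact_mod_cast (by omega : n ≤ k)
  have hr := isRegularLocalRing_of_span _ hm hdim
  exact ⟨hr, le_antisymm (ringKrullDim_le_of_span _ hm) hdim⟩

theorem isField_of_ringKrullDim_eq_zero [IsRegularLocalRing A] (h : ringKrullDim A = 0) :
    IsField A := by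
  obtain ⟨y, hy⟩ := exists_span_range_eq_maximalIdeal (n := 0) (A := A) (by simpa using h)
  rw [IsLocalRing.isField_iff_maximalIdeal_eq, ← hy]
  simp

/-- Avoidance of `𝔪²` and of finitely many primes. -/
theorem exists_mem_maximalIdeal_notMem [IsLocalRing A] [IsNoetherianRing A]
    (hm : maximalIdeal A ≠ ⊥) {s : Set (Ideal A)} (hs : s.Finite) (hp : ∀ P ∈ s, P.IsPrime)
    (hne : ∀ P ∈ s, P ≠ maximalIdeal A) :
    ∃ x ∈ maximalIdeal A, x ∉ maximalIdeal A ^ 2 ∧ ∀ P ∈ s, x ∉ P := by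
  classical
  by_contra! h
  have h1 : (maximalIdeal A : Set A) ⊆
      ⋃ i ∈ ((insert (maximalIdeal A ^ 2) hs.toFinset : Finset (Ideal A)) : Set (Ideal A)),
        ((id i : Ideal A) : Set A) := by
    intro x hx
    by_cases hx2 : x ∈ maximalIdeal A ^ 2
    · simp only [Set.mem_iUnion]
      exact ⟨_, by simp, hx2⟩
    · obtain ⟨P, hP, hxP⟩ := h x hx hx2
      simp only [Set.mem_iUnion]
      exact ⟨P, by simp [hP], hxP⟩
  -- Prime avoidance tolerates two members that are not prime; 𝔪² takes both exceptional places. If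
  -- 𝔪 ⊆ 𝔪², Nakayama gives 𝔪 = 0.
  rw [Ideal.subset_union_prime (maximalIdeal A ^ 2) (maximalIdeal A ^ 2)] at h1
  · obtain ⟨P, hP, hle⟩ := h1
    rw [Finset.mem_insert, Set.Finite.mem_toFinset] at hP
    rcases hP with rfl | hP
    · apply hm
      refine Submodule.eq_bot_of_le_smul_of_le_jacobson_bot (maximalIdeal A) _
        (IsNoetherian.noetherian _) ?_ (IsLocalRing.maximalIdeal_le_jacobson _)
      rw [smul_eq_mul, ← pow_two]; exact hle
    · have := (hp P hP).ne_top
      exact hne P hP (le_antisymm (le_maximalIdeal this) hle)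
  · intro i hi h1 _
    rw [Finset.mem_insert, Set.Finite.mem_toFinset] at hi
    exact hp i (hi.resolve_left h1)

/-- Induction on the dimension. For x outside 𝔪² and all minimal primes, (x) is prime because the
quotient is regular of smaller dimension. A minimal prime P inside (x) does not contain x, so P =
xP, and P = 0 by Nakayama. -/
theorem isDomain_of_isRegularLocalRing [IsRegularLocalRing A] : IsDomain A := by
  obtain ⟨n, hn⟩ := exists_ringKrullDim_eq (A := A)
  induction n generalizing A with
  | zero => exact (isField_of_ringKrullDim_eq_zero (by simpa using hn)).isDomain
  | succ n ih =>
    have hm : ¬ maximalIdeal A ∈ minimalPrimes A := by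
      intro h
      have h0 : (maximalIdeal A).height = 0 := by
        exact Ideal.height_eq_zero_iff.mpr h
      have := IsLocalRing.maximalIdeal_height_eq_ringKrullDim (R := A)
      rw [h0, hn] at this
      have : (0 : ℕ) = n + 1 := by exact_mod_cast this
      omega
    have hm0 : maximalIdeal A ≠ ⊥ := by
      intro h
      apply hm
      have := IsLocalRing.isField_iff_maximalIdeal_eq.mpr h
      let := this.toField
      rw [h, IsDomain.minimalPrimes_eq_singleton_bot]; rfl
    obtain ⟨x, hx, hx2, hxP⟩ := exists_mem_maximalIdeal_notMem hm0
      (minimalPrimes.finite_of_isNoetherianRing A) (fun P hP => hP.1.1)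
      (fun P hP h => hm (h ▸ hP))
    obtain ⟨hr, hd⟩ := isRegularLocalRing_quotient hn hx hx2
    have hdom := ih hd
    have hprime : (Ideal.span {x}).IsPrime := (Ideal.Quotient.isDomain_iff_prime _).mp hdom
    obtain ⟨P, hP, hPx⟩ := Ideal.exists_minimalPrimes_le (bot_le (a := Ideal.span {x}))
    have hPp : P.IsPrime := hP.1.1
    have hP0 : P = ⊥ := by
      refine Submodule.eq_bot_of_le_smul_of_le_jacobson_bot (Ideal.span {x}) _
        (IsNoetherian.noetherian _) ?_ (((Ideal.span_singleton_le_iff_mem _).mpr hx).trans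
          (IsLocalRing.maximalIdeal_le_jacobson _))
      intro p hp
      obtain ⟨c, rfl⟩ := Ideal.mem_span_singleton'.mp (hPx hp)
      have hc := (hPp.mem_or_mem hp).resolve_right (hxP P hP)
      rw [mul_comm, smul_eq_mul]
      exact Ideal.mul_mem_mul (Ideal.mem_span_singleton_self x) hc
    rw [hP0, ← Ideal.Quotient.isDomain_iff_prime] at hPp
    exact (MulEquiv.isDomain _ (RingEquiv.quotientBot A).symm.toMulEquiv :)

end RegularLocal

/-! ### Projective dimension over local rings -/

section ProjectiveDimension

open CategoryTheory

universe u

/-- `M` has projective dimension at most `n`. -/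
abbrev PdLE (A : Type u) [CommRing A] (M : Type u) [AddCommGroup M] [Module A M] (n : ℕ) : Prop :=
  HasProjectiveDimensionLE (ModuleCat.of A M) n

variable {A : Type u} [CommRing A]

theorem pdLE_zero_iff (M : Type u) [AddCommGroup M] [Module A M] :
    PdLE A M 0 ↔ Module.Projective A M := by
  rw [PdLE, ← projective_iff_hasProjectiveDimensionLE_zero, ← IsProjective.iff_projective]

theorem pdLE_succ_iff {P M : Type u} [AddCommGroup P] [Module A P] [AddCommGroup M] [Module A M]
    [Module.Projective A P] (f : P →ₗ[A] M) (hf : Function.Surjective f) (n : ℕ) :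
    PdLE A M (n + 1) ↔ PdLE A (LinearMap.ker f) n := by
  have h := LinearMap.shortExact_shortComplexKer hf
  exact h.hasProjectiveDimensionLT_X₃_iff n
    ((IsProjective.iff_projective (R := A) (P := P)).mp inferInstance)

theorem PdLE.mono {M : Type u} [AddCommGroup M] [Module A M] {n m : ℕ} (h : PdLE A M n)
    (hnm : n ≤ m) : PdLE A M m :=
  have := h
  hasProjectiveDimensionLT_of_ge _ (n + 1) (m + 1) (by omega)

theorem PdLE.retract {M N : Type u} [AddCommGroup M] [Module A M] [AddCommGroup N] [Module A N]
    {n : ℕ} (h : PdLE A N n) (i : M →ₗ[A] N) (r : N →ₗ[A] M) (hri : r ∘ₗ i = LinearMap.id) :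
    PdLE A M n := by
  have hr : Retract (ModuleCat.of A M) (ModuleCat.of A N) :=
    { i := ModuleCat.ofHom i
      r := ModuleCat.ofHom r
      retract := by rw [← ModuleCat.ofHom_comp, hri]; rfl }
  have := h
  exact hr.hasProjectiveDimensionLT (n + 1)

theorem PdLE.equiv {M N : Type u} [AddCommGroup M] [Module A M] [AddCommGroup N] [Module A N]
    {n : ℕ} (h : PdLE A M n) (e : M ≃ₗ[A] N) : PdLE A N n :=
  h.retract e.symm.toLinearMap e.toLinearMap (by ext; simp)

/-- Induction along syzygies. For n = 0 both sides mean freeness, which can be tested modulo x. In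
the step, regularity of x on M keeps the presentation exact on the left after reduction, so the
syzygy of M/xM is the reduced syzygy of M. -/
theorem pdLE_quotSMulTop_iff [IsLocalRing A] [IsNoetherianRing A] {x : A}
    (hx : x ∈ maximalIdeal A) (hreg : IsSMulRegular A x) {M : Type u} [AddCommGroup M] [Module A M]
    [Module.Finite A M] (hM : IsSMulRegular M x) (n : ℕ) :
    PdLE (A ⧸ Ideal.span {x}) (QuotSMulTop x M) n ↔ PdLE A M n := by
  have hne : Ideal.span {x} ≠ ⊤ := by
    rw [Ne, Ideal.span_singleton_eq_top]; exact hx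
  have := Ideal.Quotient.nontrivial_iff.mpr hne
  have : IsLocalRing (A ⧸ Ideal.span {x}) := .of_surjective' _ Ideal.Quotient.mk_surjective
  induction n generalizing M with
  | zero =>
    rw [pdLE_zero_iff, pdLE_zero_iff]
    have := Module.finitePresentation_of_finite A M
    have h := Module.free_quotSMulTop_iff_free A M (IsLocalRing.maximalIdeal_le_jacobson _ hx) hM
    constructor
    · intro hp
      have := Module.Finite.of_restrictScalars_finite A (A ⧸ Ideal.span {x}) (QuotSMulTop x M)
      have hfree : Module.Free (A ⧸ Ideal.span {x}) (QuotSMulTop x M) :=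
        Module.free_of_flat_of_isLocalRing
      have := h.mp hfree
      infer_instance
    · intro hp
      have hfree : Module.Free A M := Module.free_of_flat_of_isLocalRing
      have := h.mpr hfree
      infer_instance
  | succ n ih =>
    obtain ⟨P, _, _, _, _, f, hf⟩ := Module.exists_finite_presentation.{u} A M
    have hP : IsSMulRegular P x := by
      have : IsSMulRegular (Module.Free.ChooseBasisIndex A P →₀ A) x := by
        intro a b hab
        ext i
        exact hreg (DFunLike.congr_fun hab i)
      exact ((Module.Free.chooseBasis A P).repr.isSMulRegular_congr x).mpr this
    have hN : IsSMulRegular (LinearMap.ker f) x := by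
      intro a b hab
      exact Subtype.ext (hP (congrArg Subtype.val hab))
    rw [pdLE_succ_iff f hf]
    let fb : QuotSMulTop x P →ₗ[A ⧸ Ideal.span {x}] QuotSMulTop x M :=
      (QuotSMulTop.map x f).extendScalarsOfSurjective Ideal.Quotient.mk_surjective
    have hfb : Function.Surjective fb := QuotSMulTop.map_surjective x hf
    rw [pdLE_succ_iff fb hfb]
    refine Iff.trans ?_ (ih hN)
    let g : QuotSMulTop x (LinearMap.ker f) →ₗ[A ⧸ Ideal.span {x}] QuotSMulTop x P :=
      (QuotSMulTop.map x (LinearMap.ker f).subtype).extendScalarsOfSurjective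
        Ideal.Quotient.mk_surjective
    have hex : Function.Exact g fb :=
      QuotSMulTop.map_exact x (LinearMap.exact_subtype_ker_map f) hf
    have hg : Function.Injective g := by
      rw [injective_iff_map_eq_zero]
      intro a ha
      obtain ⟨a, rfl⟩ := Submodule.Quotient.mk_surjective _ a
      have h1 : (Submodule.Quotient.mk (a : P) : QuotSMulTop x P) = 0 := ha
      rw [Submodule.Quotient.mk_eq_zero] at h1 ⊢
      obtain ⟨p, -, hp⟩ := (Submodule.mem_smul_pointwise_iff_exists _ _ _).mp h1
      have hfp : f p = 0 := by
        have h2 : x • f p = x • (0 : M) := by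
          rw [← map_smul, hp, smul_zero]
          exact a.2
        exact hM h2
      exact (Submodule.mem_smul_pointwise_iff_exists _ _ _).mpr
        ⟨⟨p, hfp⟩, trivial, Subtype.ext hp⟩
    let e : QuotSMulTop x (LinearMap.ker f) ≃ₗ[A ⧸ Ideal.span {x}] LinearMap.ker fb :=
      LinearEquiv.ofBijective (g.codRestrict _ fun a => (hex (g a)).mpr ⟨a, rfl⟩)
        ⟨fun a b hab => hg (congrArg Subtype.val hab), fun b => by
          obtain ⟨a, ha⟩ := (hex b).mp b.2
          exact ⟨a, Subtype.ext ha⟩⟩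
    exact ⟨fun h => PdLE.equiv h e.symm, fun h => PdLE.equiv h e⟩

/-- Over a regular local ring every finite module has finite projective dimension. -/
theorem pdLE_of_isRegularLocalRing [IsRegularLocalRing A] {n : ℕ} (hn : ringKrullDim A = n)
    (M : Type u) [AddCommGroup M] [Module A M] [Module.Finite A M] : PdLE A M n := by
  induction n generalizing A M with
  | zero =>
    let := (isField_of_ringKrullDim_eq_zero (A := A) (by simpa using hn)).toField
    rw [pdLE_zero_iff]
    infer_instance
  | succ n ih =>
    have hm0 : maximalIdeal A ≠ ⊥ := by
      intro h
      let := (IsLocalRing.isField_iff_maximalIdeal_eq.mpr h).toField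
      rw [ringKrullDim_eq_zero_of_field] at hn
      have : (0 : ℕ) = n + 1 := by exact_mod_cast hn
      omega
    have := isDomain_of_isRegularLocalRing (A := A)
    obtain ⟨x, hx, hx2, -⟩ := exists_mem_maximalIdeal_notMem hm0
      (s := ∅) Set.finite_empty (by simp) (by simp)
    have hx0 : x ≠ 0 := by rintro rfl; simp at hx2
    obtain ⟨hr, hd⟩ := isRegularLocalRing_quotient hn hx hx2
    obtain ⟨P, _, _, _, _, f, hf⟩ := Module.exists_finite_presentation.{u} A M
    -- M may have x-torsion, but its syzygy inside a free module has none; passing to it costs the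
    -- one unit that reduction modulo x gains.
    rw [pdLE_succ_iff f hf]
    have hreg : IsSMulRegular A x := fun a b hab => mul_left_cancel₀ hx0 hab
    have hN : IsSMulRegular (LinearMap.ker f) x := fun a b hab => by
      have : Module.IsTorsionFree A P := inferInstance
      exact Subtype.ext (smul_right_injective P hx0 (congrArg Subtype.val hab))
    rw [← pdLE_quotSMulTop_iff hx hreg hN]
    have := Module.Finite.of_restrictScalars_finite A (A ⧸ Ideal.span {x})
      (QuotSMulTop x (LinearMap.ker f))
    exact ih hd _

/-- Start of a minimal resolution: a relation with a unit coefficient would make one of a minimal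
number of generators superfluous. -/
theorem exists_surjective_ker_le [IsLocalRing A] (M : Type u) [AddCommGroup M] [Module A M]
    [Module.Finite A M] : ∃ (t : Finset M) (f : (t → A) →ₗ[A] M), Function.Surjective f ∧
      ∀ c, f c = 0 → ∀ i, c i ∈ maximalIdeal A := by
  classical
  obtain ⟨t, ht, htop⟩ := Submodule.FG.exists_span_finset_card_eq_spanFinrank
    (Module.Finite.fg_top (R := A) (M := M))
  refine ⟨t, Fintype.linearCombination A (fun i : t => (i : M)), ?_, ?_⟩
  · rw [← LinearMap.range_eq_top, Fintype.range_linearCombination, ← htop]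
    exact congrArg _ Subtype.range_coe
  · intro c hc i
    by_contra hu
    have hu : IsUnit (c i) := by simpa using hu
    have hi : (i : M) ∈ Submodule.span A ((t.erase (i : M) : Finset M) : Set M) := by
      rw [Fintype.linearCombination_apply, ← Finset.add_sum_erase _ _ (Finset.mem_univ i),
        add_eq_zero_iff_eq_neg] at hc
      have h1 : c i • (i : M) ∈ Submodule.span A ((t.erase (i : M) : Finset M) : Set M) := by
        rw [hc]
        refine Submodule.neg_mem _ (Submodule.sum_mem _ fun j hj => Submodule.smul_mem _ _
          (Submodule.subset_span ?_))
        simp only [Finset.coe_erase, Set.mem_sdiff, Finset.mem_coe, Set.mem_singleton_iff]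
        exact ⟨j.2, fun h => Finset.ne_of_mem_erase hj (Subtype.ext h)⟩
      obtain ⟨u, hu⟩ := hu
      have := Submodule.smul_mem _ (↑u⁻¹ : A) h1
      rwa [← hu, smul_smul, Units.inv_mul, one_smul] at this
    have h2 : Submodule.span A ((t.erase (i : M) : Finset M) : Set M) = ⊤ := by
      rw [eq_top_iff, ← htop, Submodule.span_le]
      intro m hm
      by_cases hmi : m = i
      · rw [hmi]; exact hi
      · exact Submodule.subset_span (by simp [hmi]; exact hm)
    have h3 := Submodule.spanFinrank_span_le_ncard_of_finite (R := A)
      (t.erase (i : M)).finite_toSet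
    rw [h2, ← ht, Set.ncard_coe_finset] at h3
    exact absurd h3 (not_le.mpr (Finset.card_erase_lt_of_mem i.2))

/-- If some nonzero `s` kills the maximal ideal, modules of finite projective dimension
are free. -/
theorem free_of_pdLE_of_socle [IsLocalRing A] [IsNoetherianRing A] {s : A} (hs0 : s ≠ 0)
    (hs : ∀ a ∈ maximalIdeal A, s * a = 0) {n : ℕ} (M : Type u) [AddCommGroup M] [Module A M]
    [Module.Finite A M] (h : PdLE A M n) : Module.Free A M := by
  induction n generalizing M with
  | zero =>
    rw [pdLE_zero_iff] at h
    exact Module.free_of_flat_of_isLocalRing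
  | succ n ih =>
    obtain ⟨t, f, hf, hker⟩ := exists_surjective_ker_le (A := A) M
    rw [pdLE_succ_iff f hf] at h
    have hfree := ih _ h
    -- The syzygy has its coordinates in 𝔪, so s kills it; but s kills no basis element of a free
    -- module.
    have hbot : LinearMap.ker f = ⊥ := by
      by_contra hne
      have : Nontrivial (LinearMap.ker f) := Submodule.nontrivial_iff_ne_bot.mpr hne
      let b := Module.Free.chooseBasis A (LinearMap.ker f)
      obtain ⟨i⟩ := b.index_nonempty
      have h1 : s • b i = 0 := by
        ext j
        exact hs _ (hker _ (b i).2 j)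
      have h2 := congrArg (fun z => b.repr z i) h1
      simp at h2
      exact hs0 h2
    exact Module.Free.of_equiv
      (LinearEquiv.ofBijective f ⟨LinearMap.ker_eq_bot.mp hbot, hf⟩)

end ProjectiveDimension

/-! ### Finite projective dimension of the residue field implies regularity -/

section Serre

open scoped Pointwise

open CategoryTheory

universe u

variable {A : Type u} [CommRing A]

/-- The map 1 ↦ q is split by r, so the cyclic module is a direct summand of Q. -/
theorem PdLE.of_retract_quotient {J : Ideal A} {Q : Type u} [AddCommGroup Q] [Module A Q] {n : ℕ}
    (h : PdLE A Q n) (q : Q) (hq : ∀ a ∈ J, a • q = 0) (r : Q →ₗ[A] A ⧸ J) (hr : r q = 1) :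
    PdLE A (A ⧸ J) n := by
  refine PdLE.retract h (Submodule.liftQ J (LinearMap.toSpanSingleton A Q q) ?_) r ?_
  · intro a ha
    rw [LinearMap.mem_ker, LinearMap.toSpanSingleton_apply]
    exact hq a ha
  · apply Submodule.linearMap_qext
    apply LinearMap.ext_ring
    rw [LinearMap.comp_assoc, Submodule.liftQ_mkQ, LinearMap.comp_apply,
      LinearMap.toSpanSingleton_apply, one_smul, hr]
    rfl

/-- A functional on `𝔪` that takes the value one at a given element outside `𝔪²`. -/
theorem exists_linearMap_apply_eq_one [IsLocalRing A] {x : A}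
    (hx : x ∈ maximalIdeal A) (hx2 : x ∉ maximalIdeal A ^ 2) :
    ∃ φ : maximalIdeal A →ₗ[A] ResidueField A, φ ⟨x, hx⟩ = 1 := by
  have hne : (maximalIdeal A).toCotangent ⟨x, hx⟩ ≠ 0 := by
    rw [Ne, Ideal.toCotangent_eq_zero]; exact hx2
  obtain ⟨ψ, hψ⟩ := Module.Projective.exists_dual_ne_zero (ResidueField A)
    (V := CotangentSpace A) hne
  refine ⟨((ψ ((maximalIdeal A).toCotangent ⟨x, hx⟩))⁻¹ • ψ).restrictScalars A ∘ₗ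
    (maximalIdeal A).toCotangent, ?_⟩
  rw [LinearMap.comp_apply, LinearMap.restrictScalars_apply, LinearMap.smul_apply, smul_eq_mul]
  exact inv_mul_cancel₀ hψ

theorem mk_mem_maximalIdeal_iff [IsLocalRing A] {x : A} [IsLocalRing (A ⧸ Ideal.span {x})]
    (a : A) : Ideal.Quotient.mk (Ideal.span {x}) a ∈ maximalIdeal (A ⧸ Ideal.span {x}) ↔
      a ∈ maximalIdeal A := by
  have : IsLocalHom (Ideal.Quotient.mk (Ideal.span {x})) :=
    IsLocalHom.of_surjective _ Ideal.Quotient.mk_surjective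
  simp

/-- Supplies the retraction that splits the residue field, spanned by the class of x, off 𝔪/x𝔪. -/
theorem exists_linearMap_quotSMulTop [IsLocalRing A] {x : A}
    (hx : x ∈ maximalIdeal A) (hx2 : x ∉ maximalIdeal A ^ 2)
    [IsLocalRing (A ⧸ Ideal.span {x})] :
    ∃ r : QuotSMulTop x (maximalIdeal A) →ₗ[A ⧸ Ideal.span {x}]
      ((A ⧸ Ideal.span {x}) ⧸ maximalIdeal (A ⧸ Ideal.span {x})),
      r (Submodule.Quotient.mk ⟨x, hx⟩) = 1 := by
  obtain ⟨φ, hφ⟩ := exists_linearMap_apply_eq_one hx hx2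
  let q : (A ⧸ maximalIdeal A) →ₗ[A]
      ((A ⧸ Ideal.span {x}) ⧸ maximalIdeal (A ⧸ Ideal.span {x})) :=
    Submodule.liftQ (maximalIdeal A) (Algebra.linearMap A _) (by
      intro a ha
      exact Ideal.Quotient.eq_zero_iff_mem.mpr ((mk_mem_maximalIdeal_iff a).mpr ha))
  have hq : q 1 = 1 := (Submodule.liftQ_apply _ _ (1 : A)).trans (map_one (algebraMap A _))
  have hle : x • (⊤ : Submodule A (maximalIdeal A)) ≤ LinearMap.ker (q ∘ₗ φ) := by
    intro a ha
    obtain ⟨b, -, rfl⟩ := (Submodule.mem_smul_pointwise_iff_exists _ _ _).mp ha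
    rw [LinearMap.mem_ker, map_smul, ← algebraMap_smul (A ⧸ Ideal.span {x}) x]
    have : algebraMap A (A ⧸ Ideal.span {x}) x = 0 :=
      Ideal.Quotient.eq_zero_iff_mem.mpr (Ideal.mem_span_singleton_self x)
    rw [this, zero_smul]
  have h1 := Submodule.liftQ_apply (x • (⊤ : Submodule A (maximalIdeal A))) (q ∘ₗ φ) (h := hle)
    ⟨x, hx⟩
  exact ⟨LinearMap.extendScalarsOfSurjective (R := A) Ideal.Quotient.mk_surjective
    (Submodule.liftQ _ (q ∘ₗ φ) hle), h1.trans ((congrArg q hφ).trans hq)⟩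

/-- 𝔪 is a syzygy of the residue field, so 𝔪/x𝔪 has bounded projective dimension over A/x; the
residue field is a direct summand of it because x lies outside 𝔪². -/
theorem pdLE_residue_quotient [IsLocalRing A] [IsNoetherianRing A] {x : A}
    (hx : x ∈ maximalIdeal A) (hx2 : x ∉ maximalIdeal A ^ 2) (hreg : IsSMulRegular A x)
    [IsLocalRing (A ⧸ Ideal.span {x})] {n : ℕ} (h : PdLE A (A ⧸ maximalIdeal A) n) :
    PdLE (A ⧸ Ideal.span {x})
      ((A ⧸ Ideal.span {x}) ⧸ maximalIdeal (A ⧸ Ideal.span {x})) n := by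
  have h1 : PdLE A (maximalIdeal A) n := by
    have h2 := (pdLE_succ_iff (Submodule.mkQ (maximalIdeal A))
      (Submodule.mkQ_surjective (maximalIdeal A)) n).mp (PdLE.mono h (Nat.le_succ n))
    exact PdLE.equiv h2 (LinearEquiv.ofEq _ _ (Submodule.ker_mkQ (maximalIdeal A)))
  have hmreg : IsSMulRegular (maximalIdeal A) x := fun a b hab =>
    Subtype.ext (hreg (congrArg Subtype.val hab))
  have h3 := (pdLE_quotSMulTop_iff hx hreg hmreg n).mpr h1
  obtain ⟨r, hr⟩ := exists_linearMap_quotSMulTop hx hx2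
  refine PdLE.of_retract_quotient h3 _ ?_ r hr
  intro b hb
  obtain ⟨a, rfl⟩ := Ideal.Quotient.mk_surjective b
  have ha := (mk_mem_maximalIdeal_iff a).mp hb
  refine (algebraMap_smul (A ⧸ Ideal.span {x}) a _).trans ?_
  rw [← Submodule.Quotient.mk_smul, Submodule.Quotient.mk_eq_zero]
  exact (Submodule.mem_smul_pointwise_iff_exists _ _ _).mpr
    ⟨⟨a, ha⟩, trivial, Subtype.ext (mul_comm x a)⟩

/-- A Noetherian local ring whose residue field has finite projective dimension is regular. -/
theorem isRegularLocalRing_of_pdLE [IsLocalRing A] [IsNoetherianRing A] {n : ℕ}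
    (h : PdLE A (A ⧸ maximalIdeal A) n) : IsRegularLocalRing A := by
  obtain ⟨d, hd⟩ := exists_ringKrullDim_eq (A := A)
  induction d using Nat.strong_induction_on generalizing A with
  | _ d ih =>
  -- In depth zero an element killed by 𝔪 forces the residue field to be free, so 𝔪 = 0. Otherwise a
  -- nonzerodivisor outside 𝔪² allows induction on the dimension.
  by_cases hass : maximalIdeal A ∈ associatedPrimes A A
  · obtain ⟨-, s, hs⟩ := isAssociatedPrime_iff.mp hass
    have hs0 : s ≠ 0 := by
      rintro rfl
      refine (Ideal.IsPrime.ne_top' (I := maximalIdeal A)) ?_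
      rw [hs, Ideal.eq_top_iff_one]
      simp
    have hfree := free_of_pdLE_of_socle hs0 (fun a ha => by
      rw [hs, Submodule.mem_colon_singleton] at ha
      rw [mul_comm]
      simpa using ha) _ h
    have hbot : maximalIdeal A = ⊥ := by
      rw [eq_bot_iff]
      intro a ha
      let b := Module.Free.chooseBasis A (A ⧸ maximalIdeal A)
      obtain ⟨i⟩ := b.index_nonempty
      have h1 : a • b i = 0 := by
        obtain ⟨c, hc⟩ := Ideal.Quotient.mk_surjective (b i)
        rw [← hc]
        exact Ideal.Quotient.eq_zero_iff_mem.mpr (Ideal.mul_mem_right c _ ha)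
      have h2 := congrArg (fun z => b.repr z i) h1
      simpa using h2
    let := (IsLocalRing.isField_iff_maximalIdeal_eq.mpr hbot).toField
    infer_instance
  · have hm0 : maximalIdeal A ≠ ⊥ := by
      intro h0
      apply hass
      let := (IsLocalRing.isField_iff_maximalIdeal_eq.mpr h0).toField
      refine isAssociatedPrime_iff.mpr ⟨inferInstance, 1, ?_⟩
      rw [h0]
      ext a
      simp [Submodule.mem_colon_singleton]
    obtain ⟨x, hx, hx2, hxP⟩ := exists_mem_maximalIdeal_notMem hm0
      (associatedPrimes.finite A A) (fun P hP => hP.1) (fun P hP h => hass (h ▸ hP))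
    have hnzd : x ∈ nonZeroDivisors A := by
      by_contra hx0
      have h1 : x ∈ ((nonZeroDivisors A : Set A))ᶜ := hx0
      rw [← biUnion_associatedPrimes_eq_compl_nonZeroDivisors] at h1
      simp only [Set.mem_iUnion] at h1
      obtain ⟨P, hP, hxP'⟩ := h1
      exact hxP P hP hxP'
    have hreg : IsSMulRegular A x := fun a b hab => by
      exact (mem_nonZeroDivisors_iff_right.mp hnzd (a - b) (by
        rw [sub_mul, sub_eq_zero, mul_comm a, mul_comm b]; exact hab)) |> sub_eq_zero.mp
    have hne : Ideal.span {x} ≠ ⊤ := by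
      rw [Ne, Ideal.span_singleton_eq_top]; exact hx
    have := Ideal.Quotient.nontrivial_iff.mpr hne
    have : IsLocalRing (A ⧸ Ideal.span {x}) := .of_surjective' _ Ideal.Quotient.mk_surjective
    obtain ⟨e, he⟩ := exists_ringKrullDim_eq (A := A ⧸ Ideal.span {x})
    have hdim := ringKrullDim_quotient_span_singleton_succ_eq_ringKrullDim_of_mem_nonZeroDivisors
      hnzd hx
    rw [hd, he] at hdim
    have hed : e + 1 = d := by exact_mod_cast hdim
    have := ih e (by omega) (pdLE_residue_quotient hx hx2 hreg h) he
    exact isRegularLocalRing_of_quotient hnzd hx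

end Serre

/-! ### Localizations and normality of regular local rings -/

section Localization

universe u

variable {A : Type u} [CommRing A]

/-- Serre: the localizations of a regular local ring are regular. -/
theorem isRegularLocalRing_localization [IsRegularLocalRing A] (P : Ideal A) [P.IsPrime] :
    IsRegularLocalRing (Localization.AtPrime P) := by
  obtain ⟨n, hn⟩ := exists_ringKrullDim_eq (A := A)
  have h : PdLE A (A ⧸ P) n := pdLE_of_isRegularLocalRing hn _
  -- Localizing a finite resolution of A/P resolves the residue field of A_P, to which Serre's
  -- criterion applies.
  have h2 := ModuleCat.localizedModule_hasProjectiveDimensionLE n P.primeCompl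
    (ModuleCat.of A (A ⧸ P))
  have hP : Submodule.localized' (Localization.AtPrime P) P.primeCompl
      (Algebra.linearMap A (Localization.AtPrime P)) P = maximalIdeal (Localization.AtPrime P) := by
    rw [Ideal.localized'_eq_map, Localization.AtPrime.map_eq_maximalIdeal]
  let e : LocalizedModule P.primeCompl (A ⧸ P) ≃ₗ[A] (Localization.AtPrime P ⧸
      Submodule.localized' (Localization.AtPrime P) P.primeCompl
        (Algebra.linearMap A (Localization.AtPrime P)) P) :=
    IsLocalizedModule.linearEquiv P.primeCompl (LocalizedModule.mkLinearMap P.primeCompl (A ⧸ P))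
      (Submodule.toLocalizedQuotient' (Localization.AtPrime P) P.primeCompl
        (Algebra.linearMap A (Localization.AtPrime P)) P)
  let e' := e.extendScalarsOfIsLocalization P.primeCompl (Localization.AtPrime P)
  rw [hP] at e'
  exact isRegularLocalRing_of_pdLE (n := n)
    (PdLE.equiv h2 ((Shrink.linearEquiv _ _).trans e'))

/-- Induction on the dimension, with a prime element x outside 𝔪². An integral fraction f lies in
A_P for every prime P not containing x, since A_P is regular of smaller dimension. Hence some power
of x clears the denominator of f, and the factors x can then be removed one by one. -/
theorem isIntegrallyClosed_of_isRegularLocalRing [IsRegularLocalRing A] [IsDomain A] :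
    IsIntegrallyClosed A := by
  obtain ⟨d, hd⟩ := exists_ringKrullDim_eq (A := A)
  induction d using Nat.strong_induction_on generalizing A with
  | _ d ih =>
  by_cases hm0 : maximalIdeal A = ⊥
  · let := (IsLocalRing.isField_iff_maximalIdeal_eq.mpr hm0).toField
    infer_instance
  obtain ⟨x, hx, hx2, -⟩ := exists_mem_maximalIdeal_notMem hm0
    (s := ∅) Set.finite_empty (by simp) (by simp)
  obtain ⟨n, rfl⟩ : ∃ n, d = n + 1 := by
    refine Nat.exists_eq_succ_of_ne_zero ?_
    rintro rfl
    exact hm0 (IsLocalRing.isField_iff_maximalIdeal_eq.mp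
      (isField_of_ringKrullDim_eq_zero (by simpa using hd)))
  obtain ⟨hr, -⟩ := isRegularLocalRing_quotient hd hx hx2
  have hdom := isDomain_of_isRegularLocalRing (A := A ⧸ Ideal.span {x})
  have hprime : (Ideal.span {x}).IsPrime := (Ideal.Quotient.isDomain_iff_prime _).mp hdom
  let K := FractionRing A
  rw [isIntegrallyClosed_iff K]
  intro f hf
  -- D is the ideal of denominators of f.
  let D : Ideal A := Submodule.comap (LinearMap.toSpanSingleton A K f)
    (LinearMap.range (Algebra.linearMap A K))
  have hD : ∀ r, r ∈ D ↔ ∃ a, algebraMap A K a = algebraMap A K r * f := by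
    intro r
    simp [D, Algebra.smul_def]
  have hxD : x ∈ D.radical := by
    rw [Ideal.radical_eq_sInf, Submodule.mem_sInf]
    refine fun (P : Ideal A) hP' => ?_
    obtain ⟨hDP, hP⟩ := hP'
    by_contra hxP
    have hreg := isRegularLocalRing_localization P
    obtain ⟨k, hk⟩ := exists_ringKrullDim_eq (A := Localization.AtPrime P)
    have hkn : k < n + 1 := by
      have h1 : P.height < (maximalIdeal A).height :=
        Ideal.height_strict_mono_of_isPrime (lt_of_le_of_ne (le_maximalIdeal hP.ne_top)
          fun h => hxP (h ▸ hx))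
      have h2 := IsLocalRing.maximalIdeal_height_eq_ringKrullDim (R := A)
      have h3 := IsLocalization.AtPrime.ringKrullDim_eq_height P (Localization.AtPrime P)
      rw [hk] at h3
      rw [hd] at h2
      have h4 : ((P.height : ℕ∞) : WithBot ℕ∞) < (maximalIdeal A).height := by exact_mod_cast h1
      rw [← h3, h2] at h4
      exact_mod_cast h4
    have hic := ih k hkn hk
    have := IsFractionRing.isFractionRing_of_isDomain_of_isLocalization P.primeCompl
      (Localization.AtPrime P) K
    obtain ⟨g, hg⟩ := (isIntegrallyClosed_iff K).mp hic (hf.tower_top)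
    obtain ⟨a, s, rfl⟩ := IsLocalization.exists_mk'_eq P.primeCompl g
    refine s.2 (hDP ((hD _).mpr ⟨a, ?_⟩))
    rw [← hg, IsScalarTower.algebraMap_apply A (Localization.AtPrime P) K,
      IsScalarTower.algebraMap_apply A (Localization.AtPrime P) K, ← map_mul]
    congr 1
    rw [mul_comm, IsLocalization.mk'_spec]
  obtain ⟨N, hN⟩ := hxD
  have hx0 : algebraMap A K x ≠ 0 := by
    rw [Ne, FaithfulSMul.algebraMap_eq_zero_iff]
    rintro rfl; simp at hx2
  induction N with
  | zero =>
    obtain ⟨a, ha⟩ := (hD _).mp hN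
    exact ⟨a, by simpa using ha⟩
  | succ N ihN =>
    apply ihN
    obtain ⟨g, hg⟩ := (hD _).mp hN
    -- Scaling the equation of f by x^(N+1) gives a monic equation for g whose lower coefficients
    -- are divisible by x; as x is prime, it divides g.
    have hgx : g ∈ Ideal.span {x} := by
      obtain ⟨p, hp, hpf⟩ := hf
      refine hprime.mem_of_pow_mem p.natDegree ?_
      have h0 : Polynomial.eval g (p.scaleRoots (x ^ (N + 1))) = 0 := by
        apply FaithfulSMul.algebraMap_injective A K
        rw [map_zero, ← Polynomial.aeval_algebraMap_apply_eq_algebraMap_eval, hg]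
        exact Polynomial.scaleRoots_aeval_eq_zero hpf
      rw [Polynomial.eval_eq_sum_range, Polynomial.natDegree_scaleRoots, Finset.sum_range_succ,
        Polynomial.coeff_scaleRoots_natDegree, hp.leadingCoeff, one_mul, add_comm] at h0
      rw [eq_neg_of_add_eq_zero_left h0]
      refine neg_mem (Ideal.sum_mem _ fun i hi => Ideal.mul_mem_right _ _ ?_)
      rw [Polynomial.coeff_scaleRoots]
      refine Ideal.mul_mem_left _ _ ?_
      rw [← pow_mul]
      refine Ideal.pow_mem_of_mem _ (Ideal.mem_span_singleton_self x) _ ?_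
      have := Finset.mem_range.mp hi
      exact Nat.mul_pos (Nat.succ_pos N) (by omega)
    obtain ⟨c, rfl⟩ := Ideal.mem_span_singleton'.mp hgx
    refine (hD _).mpr ⟨c, ?_⟩
    refine mul_right_cancel₀ hx0 ?_
    rw [← map_mul, hg, pow_succ, map_mul]
    ring

end Localization

/-! ### Local subrings of a field, domination and affine models -/

section LocalSubrings

variable {K : Type*} [Field K]

theorem isUnit_iff_inv_mem {W : Subring K} {y : W} : IsUnit y ↔ (y : K) ≠ 0 ∧ (y : K)⁻¹ ∈ W := by
  constructor
  · intro h
    obtain ⟨z, hz⟩ := h.exists_right_inv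
    have h1 : (y : K) * z = 1 := congrArg Subtype.val hz
    have h0 : (y : K) ≠ 0 := left_ne_zero_of_mul_eq_one h1
    refine ⟨h0, ?_⟩
    rw [← eq_inv_of_mul_eq_one_right h1]
    exact z.2
  · rintro ⟨h0, h⟩
    exact IsUnit.of_mul_eq_one ⟨_, h⟩ (Subtype.ext (mul_inv_cancel₀ h0))

theorem mem_maximalIdeal_iff_inv {W : LocalSubring K} {y : W.toSubring} :
    y ∈ maximalIdeal W.toSubring ↔ ((y : K) ≠ 0 → (y : K)⁻¹ ∉ W.toSubring) := by
  rw [mem_maximalIdeal, mem_nonunits_iff, isUnit_iff_inv_mem, not_and]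

theorem le_iff_inv_mem {S T : LocalSubring K} : S ≤ T ↔ S.toSubring ≤ T.toSubring ∧
    ∀ x ∈ S.toSubring, x ≠ 0 → x⁻¹ ∈ T.toSubring → x⁻¹ ∈ S.toSubring := by
  rw [LocalSubring.le_def]
  constructor
  · rintro ⟨h, hl⟩
    refine ⟨h, fun x hx h0 hT => ?_⟩
    have h1 : IsUnit (Subring.inclusion h ⟨x, hx⟩) := isUnit_iff_inv_mem.mpr ⟨h0, hT⟩
    exact (isUnit_iff_inv_mem.mp (hl.map_nonunit _ h1)).2
  · rintro ⟨h, hl⟩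
    refine ⟨h, ⟨fun x hx => ?_⟩⟩
    obtain ⟨h0, h1⟩ := isUnit_iff_inv_mem.mp hx
    exact isUnit_iff_inv_mem.mpr ⟨h0, hl x x.2 h0 h1⟩

theorem mem_ofPrime_iff {A : Subring K} {P : Ideal A} [P.IsPrime] {x : K} :
    x ∈ (LocalSubring.ofPrime A P).toSubring ↔ ∃ a s : A, s ∉ P ∧ x = a / s := by
  constructor
  · intro hx
    obtain ⟨a, s, h⟩ := IsLocalization.exists_mk'_eq P.primeCompl
      (⟨x, hx⟩ : (LocalSubring.ofPrime A P).toSubring)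
    refine ⟨a, s, s.2, ?_⟩
    have hs : ((s : A) : K) ≠ 0 := fun h0 => s.2 (by
      rw [show (s : A) = 0 from Subtype.ext h0]; exact P.zero_mem)
    have h2 := IsLocalization.mk'_spec (LocalSubring.ofPrime A P).toSubring a s
    rw [h] at h2
    rw [eq_div_iff hs]
    exact congrArg Subtype.val h2
  · rintro ⟨a, s, hs, rfl⟩
    have hs0 : (s : K) ≠ 0 := fun h0 => hs (by
      rw [show s = 0 from Subtype.ext h0]; exact P.zero_mem)
    have h2 := IsLocalization.mk'_spec (LocalSubring.ofPrime A P).toSubring a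
      (⟨s, hs⟩ : P.primeCompl)
    have h3 : ((IsLocalization.mk' (LocalSubring.ofPrime A P).toSubring a
      (⟨s, hs⟩ : P.primeCompl) : (LocalSubring.ofPrime A P).toSubring) : K) * s = a :=
      congrArg Subtype.val h2
    rw [← (eq_div_iff hs0).mpr h3]
    exact Subtype.property _

theorem inv_mem_ofPrime_iff {A : Subring K} {P : Ideal A} [P.IsPrime] {s : A} (h0 : (s : K) ≠ 0) :
    (s : K)⁻¹ ∈ (LocalSubring.ofPrime A P).toSubring ↔ s ∉ P := by
  constructor
  · intro h hs
    obtain ⟨a, t, ht, hat⟩ := mem_ofPrime_iff.mp h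
    have ht0 : (t : K) ≠ 0 := fun h0 => ht (by
      rw [show t = 0 from Subtype.ext h0]; exact P.zero_mem)
    have : t = a * s := Subtype.ext (by
      push_cast
      field_simp at hat
      rw [mul_comm]; exact hat)
    exact ht (this ▸ P.mul_mem_left _ hs)
  · intro hs
    exact mem_ofPrime_iff.mpr ⟨1, s, hs, by simp⟩

/-- This localization is the centre of V on the affine model of A. -/
theorem ofPrime_le {A : Subring K} {V : LocalSubring K} (h : A ≤ V.toSubring) :
    LocalSubring.ofPrime A ((maximalIdeal V.toSubring).comap (Subring.inclusion h)) ≤ V := by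
  have key : ∀ s : A, s ∉ (maximalIdeal V.toSubring).comap (Subring.inclusion h) →
      (s : K) ≠ 0 ∧ (s : K)⁻¹ ∈ V.toSubring := fun s hs => by
    have h1 : IsUnit (Subring.inclusion h s) := by
      by_contra h2
      exact hs h2
    exact isUnit_iff_inv_mem.mp h1
  rw [le_iff_inv_mem]
  refine ⟨?_, ?_⟩
  · intro x hx
    obtain ⟨a, s, hs, rfl⟩ := mem_ofPrime_iff.mp hx
    rw [div_eq_mul_inv]
    exact mul_mem (h a.2) (key s hs).2
  · intro x hx h0 hinv
    obtain ⟨a, s, hs, rfl⟩ := mem_ofPrime_iff.mp hx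
    rw [inv_div]
    refine mem_ofPrime_iff.mpr ⟨s, a, fun ha => ?_, rfl⟩
    have ha' : Subring.inclusion h a ∈ maximalIdeal V.toSubring := ha
    have ha0 : (a : K) ≠ 0 := fun h1 => h0 (by rw [h1, zero_div])
    refine mem_maximalIdeal_iff_inv.mp ha' ha0 ?_
    have h3 : (a : K)⁻¹ = ((a : K) / s)⁻¹ * (s : K)⁻¹ := by
      have := (key s hs).1
      field_simp
    exact h3 ▸ mul_mem hinv (key s hs).2

/-- No prime is named here, so transitivity and change of the base ring become calculations with
fractions; the prime is recovered as the contraction of the maximal ideal of W. -/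
theorem mem_affineModel_iff {A : Subring K} {W : LocalSubring K} : W ∈ affineModel A ↔
    A ≤ W.toSubring ∧ ∀ x ∈ W.toSubring, ∃ a ∈ A, ∃ s ∈ A,
      s ≠ 0 ∧ s⁻¹ ∈ W.toSubring ∧ x = a / s := by
  constructor
  · rintro ⟨P, hP, rfl⟩
    refine ⟨LocalSubring.le_ofPrime A P, fun x hx => ?_⟩
    obtain ⟨a, s, hs, rfl⟩ := mem_ofPrime_iff.mp hx
    have hs0 : (s : K) ≠ 0 := fun h0 => hs (by
      rw [show s = 0 from Subtype.ext h0]; exact P.zero_mem)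
    exact ⟨a, a.2, s, s.2, hs0, (inv_mem_ofPrime_iff hs0).mpr hs, rfl⟩
  · rintro ⟨h, hx⟩
    refine ⟨_, inferInstance, le_antisymm ?_ (ofPrime_le h)⟩
    rw [le_iff_inv_mem]
    have key : W.toSubring ≤ (LocalSubring.ofPrime A
        ((maximalIdeal W.toSubring).comap (Subring.inclusion h))).toSubring := by
      intro x hxW
      obtain ⟨a, ha, s, hs, hs0, hsi, rfl⟩ := hx x hxW
      refine mem_ofPrime_iff.mpr ⟨⟨a, ha⟩, ⟨s, hs⟩, fun hm => ?_, rfl⟩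
      exact mem_maximalIdeal_iff_inv.mp hm hs0 hsi
    exact ⟨key, fun x hxW h0 hinv => (ofPrime_le h).1 hinv⟩

theorem exists_mem_affineModel_le {A : Subring K} {V : LocalSubring K} (h : A ≤ V.toSubring) :
    ∃ T ∈ affineModel A, T ≤ V :=
  ⟨_, ⟨_, inferInstance, rfl⟩, ofPrime_le h⟩

theorem mem_affineModel_of_le {A B : Subring K} {W : LocalSubring K} (h : W ∈ affineModel A)
    (hAB : A ≤ B) (hBW : B ≤ W.toSubring) : W ∈ affineModel B := by
  rw [mem_affineModel_iff] at h ⊢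
  refine ⟨hBW, fun x hx => ?_⟩
  obtain ⟨a, ha, s, hs, h'⟩ := h.2 x hx
  exact ⟨a, hAB ha, s, hAB hs, h'⟩

theorem mem_affineModel_trans {A : Subring K} {T W : LocalSubring K} (hT : T ∈ affineModel A)
    (hW : W ∈ affineModel T.toSubring) : W ∈ affineModel A := by
  rw [mem_affineModel_iff] at hT hW ⊢
  refine ⟨hT.1.trans hW.1, fun x hx => ?_⟩
  obtain ⟨t, ht, u, hu, hu0, hui, rfl⟩ := hW.2 x hx
  obtain ⟨a, ha, s, hs, hs0, hsi, rfl⟩ := hT.2 t ht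
  obtain ⟨b, hb, r, hr, hr0, hri, rfl⟩ := hT.2 u hu
  have hb0 : b ≠ 0 := by rintro rfl; simp at hu0
  refine ⟨a * r, mul_mem ha hr, s * b, mul_mem hs hb, mul_ne_zero hs0 hb0, ?_, by field_simp⟩
  have : (s * b)⁻¹ = s⁻¹ * ((b / r)⁻¹ * r⁻¹) := by field_simp
  rw [this]
  exact mul_mem (hW.1 hsi) (mul_mem hui (hW.1 hri))

theorem le_of_mem_affineModel {A : Subring K} {W : LocalSubring K} (h : W ∈ affineModel A) :
    A ≤ W.toSubring := (mem_affineModel_iff.mp h).1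

theorem isNoetherianRing_of_mem_affineModel {A : Subring K} {W : LocalSubring K}
    (hW : W ∈ affineModel A) [IsNoetherianRing A] : IsNoetherianRing W.toSubring := by
  obtain ⟨P, hP, rfl⟩ := hW
  exact IsLocalization.isNoetherianRing P.primeCompl _ inferInstance

theorem isFractionRing_iff {A : Subring K} :
    IsFractionRing A K ↔ ∀ x : K, ∃ a ∈ A, ∃ b ∈ A, b ≠ 0 ∧ x = a / b := by
  constructor
  · intro h x
    obtain ⟨a, b, hb, rfl⟩ := IsFractionRing.div_surjective (A := A) x
    refine ⟨a, a.2, b, b.2, ?_, rfl⟩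
    intro h0
    exact nonZeroDivisors.ne_zero hb (Subtype.ext h0)
  · intro h
    refine IsFractionRing.of_field A K fun x => ?_
    obtain ⟨a, ha, b, hb, -, rfl⟩ := h x
    exact ⟨⟨a, ha⟩, ⟨b, hb⟩, rfl⟩

theorem isFractionRing_of_le {A B : Subring K} (h : A ≤ B) [hA : IsFractionRing A K] :
    IsFractionRing B K := by
  rw [isFractionRing_iff] at hA ⊢
  intro x
  obtain ⟨a, ha, b, hb, h'⟩ := hA x
  exact ⟨a, h ha, b, h hb, h'⟩

/-- The normalized order function of a discrete valuation ring. -/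
theorem exists_ord (B : Subring K) [IsDiscreteValuationRing B] [IsFractionRing B K] :
    ∃ w : K → ℤ, (∀ x y, x ≠ 0 → y ≠ 0 → w (x * y) = w x + w y) ∧
      ∀ x, x ≠ 0 → (x ∈ B ↔ 0 ≤ w x) := by
  let v := (IsDiscreteValuationRing.maximalIdeal B).valuation K
  refine ⟨fun x => - WithZero.log (v x), fun x y hx hy => ?_, fun x hx => ?_⟩
  · beta_reduce
    rw [map_mul, WithZero.log_mul ((map_ne_zero v).mpr hx) ((map_ne_zero v).mpr hy), neg_add]
  · have h1 : 0 ≤ - WithZero.log (v x) ↔ v x ≤ 1 := by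
      rw [neg_nonneg, ← WithZero.log_one,
        WithZero.log_le_log ((map_ne_zero v).mpr hx) one_ne_zero]
    rw [h1]
    constructor
    · intro hxB
      exact IsDedekindDomain.HeightOneSpectrum.valuation_le_one _ (⟨x, hxB⟩ : B)
    · intro h
      obtain ⟨a, ha⟩ := IsDiscreteValuationRing.exists_lift_of_le_one h
      rw [← ha]; exact a.2

end LocalSubrings

/-! ### Height one primes of normal Noetherian domains -/

section Normal

variable {A : Type*} [CommRing A] [IsDomain A] [IsNoetherianRing A]

/-- Take an associated prime P = (b : c) of A/b containing (b : a). If cP ⊆ bP, then c/b is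
integral, hence in A, and P = A. So pc = bu for some p ∈ P and u ∉ P, which makes P minimal over p;
Krull's principal ideal theorem bounds its height. -/
theorem exists_height_one_of_not_dvd [IsIntegrallyClosed A] {a b : A} (hb : b ≠ 0)
    (hab : ¬ b ∣ a) : ∃ P : Ideal A, P.IsPrime ∧ P.height = 1 ∧ ∀ s ∉ P, ¬ b ∣ s * a := by
  have hne : Ideal.Quotient.mk (Ideal.span {b}) a ≠ 0 := by
    rwa [Ne, Ideal.Quotient.eq_zero_iff_mem, Ideal.mem_span_singleton]
  obtain ⟨P, hP, hle⟩ := exists_le_isAssociatedPrime_of_isNoetherianRing A _ hne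
  obtain ⟨hPp, c', hc'⟩ := isAssociatedPrime_iff.mp hP
  obtain ⟨c, rfl⟩ := Ideal.Quotient.mk_surjective c'
  have hmem : ∀ (r d : A), r ∈ (⊥ : Submodule A (A ⧸ Ideal.span {b})).colon
      {Ideal.Quotient.mk (Ideal.span {b}) d} ↔ b ∣ r * d := fun r d => by
    rw [Submodule.mem_colon_singleton, Submodule.mem_bot, ← Ideal.mem_span_singleton,
      ← Ideal.Quotient.eq_zero_iff_mem]
    rfl
  have hPc : ∀ r, r ∈ P ↔ b ∣ r * c := fun r => by rw [hc', hmem]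
  refine ⟨P, hPp, ?_, fun s hs hd => hs (hle ((hmem s a).mpr hd))⟩
  have hbP : b ∈ P := (hPc b).mpr (dvd_mul_right b c)
  obtain ⟨p, hp, u, hu, hpu⟩ : ∃ p ∈ P, ∃ u ∉ P, p * c = b * u := by
    by_contra! h
    have hcb_int :
        IsIntegral A (algebraMap A (FractionRing A) c / algebraMap A (FractionRing A) b) := by
      have hb' : algebraMap A (FractionRing A) b ≠ 0 := by simpa using hb
      refine isIntegral_of_smul_mem_submodule
        (N := Submodule.map (Algebra.linearMap A (FractionRing A)) P) ?_ ?_ _ ?_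
      · intro h0
        have : algebraMap A (FractionRing A) b ∈
          Submodule.map (Algebra.linearMap A (FractionRing A)) P := ⟨b, hbP, rfl⟩
        rw [h0] at this
        exact hb' (by simpa using this)
      · exact (IsNoetherian.noetherian P).map _
      · rintro _ ⟨q, hq, rfl⟩
        obtain ⟨w, hw⟩ := (hPc q).mp hq
        refine ⟨w, by_contra fun hwP => h q hq w hwP hw, ?_⟩
        rw [Algebra.linearMap_apply, Algebra.linearMap_apply, smul_eq_mul, div_mul_eq_mul_div,
          eq_div_iff hb', ← map_mul, ← map_mul, mul_comm c, hw, mul_comm]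
    obtain ⟨d, hd⟩ := IsIntegrallyClosed.isIntegral_iff.mp hcb_int
    have hb' : algebraMap A (FractionRing A) b ≠ 0 := by simpa using hb
    rw [eq_div_iff hb', ← map_mul] at hd
    have hdc := FaithfulSMul.algebraMap_injective A (FractionRing A) hd
    apply hPp.ne_top
    rw [Ideal.eq_top_iff_one, hPc, one_mul]
    exact ⟨d, by rw [← hdc, mul_comm]⟩
  have hmin : P ∈ (Ideal.span {p}).minimalPrimes := by
    refine ⟨⟨hPp, (Ideal.span_singleton_le_iff_mem _).mpr hp⟩, ?_⟩
    rintro Q ⟨hQ, hpQ⟩ hQP q hq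
    obtain ⟨w, hw⟩ := (hPc q).mp hq
    have h1 : u * q = p * w := by
      apply mul_left_cancel₀ hb
      calc b * (u * q) = (p * c) * q := by rw [hpu]; ring
        _ = p * (q * c) := by ring
        _ = b * (p * w) := by rw [hw]; ring
    have h2 : u * q ∈ Q := h1 ▸ Q.mul_mem_right _ (hpQ (Ideal.mem_span_singleton_self p))
    exact (hQ.mem_or_mem h2).resolve_left fun h => hu (hQP h)
  refine le_antisymm (Ideal.height_le_one_of_isPrincipal_of_mem_minimalPrimes _ P hmin) ?_
  rw [Order.one_le_iff_ne_zero]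
  intro h0
  rw [Ideal.height_eq_zero_iff, IsDomain.minimalPrimes_eq_singleton_bot,
    Set.mem_singleton_iff] at h0
  rw [h0] at hbP
  exact hb (by simpa using hbP)

theorem isDiscreteValuationRing_of_height_one [IsIntegrallyClosed A] (P : Ideal A) [P.IsPrime]
    (hP : P.height = 1) (B : Type*) [CommRing B] [IsDomain B] [Algebra A B]
    [IsLocalization.AtPrime B P] : IsDiscreteValuationRing B := by
  have : IsLocalRing B := IsLocalization.AtPrime.isLocalRing B P
  have : IsNoetherianRing B := IsLocalization.isNoetherianRing P.primeCompl B inferInstance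
  have : IsIntegrallyClosed B :=
    isIntegrallyClosed_of_isLocalization B P.primeCompl P.primeCompl_le_nonZeroDivisors
  have hd := IsLocalization.AtPrime.ringKrullDim_eq_height P B
  rw [hP] at hd
  have hf : ¬ IsField B := by
    intro h
    rw [ringKrullDim_eq_zero_of_isField h] at hd
    exact absurd hd (by simp)
  have htfae : IsDiscreteValuationRing B ↔
      IsIntegrallyClosed B ∧ ∃! Q : Ideal B, Q ≠ ⊥ ∧ Q.IsPrime :=
    (IsDiscreteValuationRing.TFAE B hf).out 0 3
  refine htfae.mpr ⟨inferInstance, maximalIdeal B,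
    ⟨isField_iff_maximalIdeal_eq.not.mp hf, inferInstance⟩, fun Q ⟨hQ0, hQ⟩ => ?_⟩
  by_contra hne
  have hlt : Q < maximalIdeal B := lt_of_le_of_ne (le_maximalIdeal hQ.ne_top) hne
  have h1 := Ideal.height_strict_mono_of_isPrime hlt
  have h2 := IsLocalRing.maximalIdeal_height_eq_ringKrullDim (R := B)
  rw [hd] at h2
  have h3 : (maximalIdeal B).height = 1 := by exact_mod_cast h2
  rw [h3, Order.lt_one_iff, Ideal.height_eq_zero_iff, IsDomain.minimalPrimes_eq_singleton_bot] at h1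
  exact hQ0 h1

end Normal

/-! ### Normal domains as intersections of discrete valuation rings -/

section Essential

variable {K : Type*} [Field K]

/-- A normal Noetherian domain is the intersection of the discrete valuation rings
among its localizations. -/
theorem mem_of_forall_dvr {A : Subring K} [IsNoetherianRing A] [IsIntegrallyClosed A]
    [hA : IsFractionRing A K] {x : K}
    (h : ∀ W ∈ affineModel A, IsDiscreteValuationRing W.toSubring → x ∈ W.toSubring) : x ∈ A := by
  obtain ⟨a, ha, b, hb, hb0, rfl⟩ := isFractionRing_iff.mp hA x
  by_contra hx
  have hdvd : ¬ (⟨b, hb⟩ : A) ∣ ⟨a, ha⟩ := by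
    rintro ⟨c, hc⟩
    apply hx
    have : a = b * c := congrArg Subtype.val hc
    rw [this, mul_div_cancel_left₀ _ hb0]
    exact c.2
  obtain ⟨P, hP, hP1, hs⟩ := exists_height_one_of_not_dvd
    (fun h0 => hb0 (congrArg Subtype.val h0)) hdvd
  obtain ⟨c, s, hsP, hcs⟩ := mem_ofPrime_iff.mp (h (LocalSubring.ofPrime A P) ⟨P, hP, rfl⟩
    (isDiscreteValuationRing_of_height_one P hP1 _))
  refine hs s hsP ⟨c, Subtype.ext ?_⟩
  have hs0 : (s : K) ≠ 0 := fun h0 => hsP (by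
    rw [show s = 0 from Subtype.ext h0]; exact P.zero_mem)
  push_cast
  rw [div_eq_div_iff hb0 hs0] at hcs
  rw [mul_comm, hcs, mul_comm]

end Essential

/-! ### Algebraic independence of the fractions y i / a modulo a -/

section AlgebraicIndependence

variable {K : Type*} [Field K]

/-- If `y` is a nonzerodivisor modulo `a`, a polynomial relation for `y / a` has its coefficients
in `(a, y)`. -/
theorem coeff_mem_span_pair {D : Type*} [CommRing D] [Algebra D K] [FaithfulSMul D K] {a y : D}
    (hreg : ∀ d, a ∣ y * d → a ∣ d) {t : K}
    (ht : algebraMap D K a * t = algebraMap D K y) (n : ℕ) (h : ℕ → D)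
    (h0 : ∑ i ∈ Finset.range (n + 1), algebraMap D K (h i) * t ^ i = 0) :
    ∀ i ≤ n, h i ∈ Ideal.span {a, y} := by
  have hpow : ∀ k d, a ∣ y ^ k * d → a ∣ d := by
    intro k
    induction k with
    | zero => intro d hd; simpa using hd
    | succ k ih => intro d hd; exact ih d (hreg _ (by rwa [pow_succ', mul_assoc] at hd))
  induction n generalizing h with
  | zero =>
    intro i hi
    obtain rfl : i = 0 := by omega
    have : h 0 = 0 := by simpa using h0
    rw [this]; exact Ideal.zero_mem _
  | succ n ih =>
    -- Multiplying the relation by a^(n+1) exhibits y^(n+1) h(n+1) as a multiple of a, and y is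
    -- regular modulo a.
    have hdvd : a ∣ h (n + 1) := by
      apply hpow (n + 1)
      refine ⟨- ∑ i ∈ Finset.range (n + 1), h i * y ^ i * a ^ (n - i), ?_⟩
      apply FaithfulSMul.algebraMap_injective D K
      rw [Finset.sum_range_succ, ← eq_neg_iff_add_eq_zero, neg_eq_iff_eq_neg.symm] at h0
      have h1 : algebraMap D K (y ^ (n + 1) * h (n + 1)) =
          algebraMap D K a ^ (n + 1) * (algebraMap D K (h (n + 1)) * t ^ (n + 1)) := by
        rw [map_mul, map_pow, ← ht]; ring
      rw [h1, ← h0, map_mul, map_neg, map_sum, mul_neg, mul_neg, Finset.mul_sum, Finset.mul_sum]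
      congr 1
      refine Finset.sum_congr rfl fun i hi => ?_
      have hi' : n = i + (n - i) := by have := Finset.mem_range.mp hi; omega
      rw [map_mul, map_mul, map_pow, map_pow, ← ht]
      conv_lhs => rw [hi']
      rw [mul_pow]; ring
    obtain ⟨c, hc⟩ := hdvd
    -- Since at = y, the top term a c t^(n+1) equals y c t^n and is absorbed into the coefficient of
    -- degree n.
    have hg := ih (fun i => if i = n then h n + y * c else h i) (by
      rw [Finset.sum_range_succ, Finset.sum_range_succ, hc] at h0
      rw [Finset.sum_range_succ, if_pos rfl]
      rw [Finset.sum_congr rfl (g := fun i => algebraMap D K (h i) * t ^ i)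
        fun i hi => by rw [if_neg (Finset.mem_range.mp hi).ne]]
      rw [map_mul, pow_succ] at h0
      rw [map_add, map_mul, ← ht, ← h0]
      ring)
    intro i hi
    rcases Nat.lt_or_ge i n with hin | hin
    · have := hg i hin.le
      rwa [if_neg hin.ne] at this
    · rcases Nat.eq_or_lt_of_le hin with rfl | hlt
      · have := hg n le_rfl
        rw [if_pos rfl] at this
        exact (Ideal.add_mem_iff_left _ (Ideal.mul_mem_right _ _
          (Ideal.subset_span (by simp)))).mp this
      · obtain rfl : i = n + 1 := by omega
        rw [hc]
        exact Ideal.mul_mem_right _ _ (Ideal.subset_span (by simp))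

variable {S : Type*} [CommRing S]

/-- Adding the elements of `y` to `a` one after the other, the last first, gives a strictly
increasing sequence of prime ideals. -/
def IsPrimeSequence (a : S) : ∀ n : ℕ, (Fin n → S) → Prop
  | 0, _ => (Ideal.span {a}).IsPrime
  | n + 1, y => IsPrimeSequence a n (Fin.tail y) ∧
      y 0 ∉ Ideal.span (insert a (Set.range (Fin.tail y))) ∧
      (Ideal.span (insert a (Set.range y))).IsPrime

theorem IsPrimeSequence.isPrime {a : S} {n : ℕ} {y : Fin n → S} (h : IsPrimeSequence a n y) :
    (Ideal.span (insert a (Set.range y))).IsPrime := by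
  cases n with
  | zero =>
    have h' : (Ideal.span {a}).IsPrime := h
    simpa using h'
  | succ n => exact h.2.2

variable [Algebra S K]

/-- Evaluation of polynomials at the fractions `y i / a`. -/
noncomputable def evalFractions (K : Type*) [Field K] [Algebra S K] (a : S) {n : ℕ}
    (y : Fin n → S) : MvPolynomial (Fin n) S →ₐ[S] K :=
  MvPolynomial.aeval fun i => algebraMap S K (y i) / algebraMap S K a

theorem evalFractions_eq_aeval_finSuccEquiv (a : S) {n : ℕ} (y : Fin (n + 1) → S)
    (F : MvPolynomial (Fin (n + 1)) S) :
    evalFractions K a y F = Polynomial.eval₂ (evalFractions K a (Fin.tail y)).toRingHom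
      (algebraMap S K (y 0) / algebraMap S K a) (MvPolynomial.finSuccEquiv S n F) := by
  induction F using MvPolynomial.induction_on with
  | C c => simp [evalFractions, MvPolynomial.finSuccEquiv_apply]
  | add p q hp hq => rw [map_add, map_add, Polynomial.eval₂_add, hp, hq]
  | mul_X p i hp =>
    rw [map_mul, map_mul, Polynomial.eval₂_mul, hp]
    congr 1
    refine Fin.cases ?_ (fun j => ?_) i
    · rw [MvPolynomial.finSuccEquiv_X_zero]; simp [evalFractions]
    · rw [MvPolynomial.finSuccEquiv_X_succ]; simp [evalFractions, Fin.tail]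

variable [FaithfulSMul S K]

theorem dvd_algebraMap_range_of_mem_span {a : S} (ha : a ≠ 0) {n : ℕ} {y : Fin n → S} {c : S}
    (hc : c ∈ Ideal.span (insert a (Set.range y))) :
    algebraMap S (evalFractions K a y).range a ∣ algebraMap S (evalFractions K a y).range c := by
  have ha' : algebraMap S K a ≠ 0 := by
    rwa [Ne, FaithfulSMul.algebraMap_eq_zero_iff]
  rw [← Ideal.mem_span_singleton, ← Ideal.mem_comap]
  refine (Ideal.span_le (I := Ideal.comap _ _)).mpr ?_ hc
  rintro _ (rfl | ⟨i, rfl⟩)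
  · exact Ideal.mem_span_singleton_self _
  · refine Ideal.mem_span_singleton.mpr ⟨⟨_, MvPolynomial.X i, rfl⟩, Subtype.ext ?_⟩
    change algebraMap S K (y i) = algebraMap S K a * evalFractions K a y (MvPolynomial.X i)
    rw [evalFractions, MvPolynomial.aeval_X, mul_div_cancel₀ _ ha']

theorem dvd_range_of_coeff_mem_span {a : S} (ha : a ≠ 0) {n : ℕ} {y : Fin n → S}
    {F : MvPolynomial (Fin n) S} (hF : ∀ m, F.coeff m ∈ Ideal.span (insert a (Set.range y))) :
    algebraMap S (evalFractions K a y).range a ∣ (evalFractions K a y).rangeRestrict F := by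
  rw [F.as_sum, map_sum]
  refine Finset.dvd_sum fun m _ => ?_
  rw [← mul_one (F.coeff m), ← MvPolynomial.C_mul_monomial, map_mul]
  refine Dvd.dvd.mul_right ?_ _
  have : (evalFractions K a y).rangeRestrict (MvPolynomial.C (F.coeff m)) =
      algebraMap S (evalFractions K a y).range (F.coeff m) :=
    (evalFractions K a y).rangeRestrict.commutes _
  rw [this]
  exact dvd_algebraMap_range_of_mem_span ha (hF m)

/-- Modulo `a`, the fractions `y i / a` are algebraically independent. -/
theorem coeff_mem_span_of_evalFractions {a : S} (ha : a ≠ 0) {n : ℕ} {y : Fin n → S}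
    (hy : IsPrimeSequence a n y) {F G : MvPolynomial (Fin n) S}
    (h : evalFractions K a y F = algebraMap S K a * evalFractions K a y G) (m : Fin n →₀ ℕ) :
    F.coeff m ∈ Ideal.span (insert a (Set.range y)) := by
  induction n with
  | zero =>
    obtain ⟨f, rfl⟩ := MvPolynomial.C_surjective (Fin 0) F
    obtain ⟨g, rfl⟩ := MvPolynomial.C_surjective (Fin 0) G
    rw [evalFractions, MvPolynomial.aeval_C, MvPolynomial.aeval_C, ← map_mul] at h
    have := FaithfulSMul.algebraMap_injective S K h
    obtain rfl : m = 0 := Subsingleton.elim _ _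
    rw [MvPolynomial.coeff_zero_C, this]
    exact Ideal.mul_mem_right _ _ (Ideal.subset_span (by simp))
  | succ n ih =>
    obtain ⟨hy1, hy0, hyp⟩ := hy
    have ha' : algebraMap S K a ≠ 0 := by
      rwa [Ne, FaithfulSMul.algebraMap_eq_zero_iff]
    let D := (evalFractions K a (Fin.tail y)).range
    let ψ : MvPolynomial (Fin n) S →ₐ[S] D := (evalFractions K a (Fin.tail y)).rangeRestrict
    have hψ : Function.Surjective ψ := AlgHom.rangeRestrict_surjective _
    -- By induction, a divides the value of a polynomial in D exactly when its coefficients lie in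
    -- the prime (a, tail y), which omits y 0.
    have hreg : ∀ d : D, algebraMap S D a ∣ algebraMap S D (y 0) * d → algebraMap S D a ∣ d := by
      rintro d ⟨e, he⟩
      obtain ⟨F', rfl⟩ := hψ d
      obtain ⟨G', rfl⟩ := hψ e
      refine dvd_range_of_coeff_mem_span ha fun m => ?_
      have h1 := ih hy1 (F := MvPolynomial.C (y 0) * F') (G := G') (by
        rw [map_mul, evalFractions, MvPolynomial.aeval_C]
        exact congrArg Subtype.val he) m
      rw [MvPolynomial.coeff_C_mul] at h1
      exact (hy1.isPrime.mem_or_mem h1).resolve_left hy0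
    rw [← Finsupp.cons_tail m, ← MvPolynomial.finSuccEquiv_coeff_coeff]
    let H := MvPolynomial.finSuccEquiv S n (F - MvPolynomial.C a * G)
    have hH : Polynomial.eval₂ (evalFractions K a (Fin.tail y)).toRingHom
        (algebraMap S K (y 0) / algebraMap S K a) H = 0 := by
      rw [← evalFractions_eq_aeval_finSuccEquiv, map_sub, map_mul, h, sub_eq_zero]
      congr 1
      simp [evalFractions]
    have hcoef : ψ (H.coeff (m 0)) ∈ Ideal.span {algebraMap S D a, algebraMap S D (y 0)} := by
      rw [Polynomial.eval₂_eq_sum_range] at hH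
      have key := coeff_mem_span_pair (K := K) (D := D) hreg
        (t := algebraMap S K (y 0) / algebraMap S K a)
        (mul_div_cancel₀ _ ha') H.natDegree
        (fun i => ψ (H.coeff i)) hH
      by_cases hm : m 0 ≤ H.natDegree
      · exact key _ hm
      · rw [Polynomial.coeff_eq_zero_of_natDegree_lt (by omega), map_zero]
        exact Ideal.zero_mem _
    obtain ⟨u, v, huv⟩ := Ideal.mem_span_pair.mp hcoef
    obtain ⟨U, rfl⟩ := hψ u
    obtain ⟨V, rfl⟩ := hψ v
    have hHc : H.coeff (m 0) = (MvPolynomial.finSuccEquiv S n F).coeff (m 0) -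
        MvPolynomial.C a * (MvPolynomial.finSuccEquiv S n G).coeff (m 0) := by
      have : MvPolynomial.finSuccEquiv S n (MvPolynomial.C a) =
          Polynomial.C (MvPolynomial.C a) := by
        simp [MvPolynomial.finSuccEquiv_apply]
      simp only [H]
      rw [map_sub, map_mul, this, Polynomial.coeff_sub,
        Polynomial.coeff_C_mul]
    -- The coefficient is congruent to y 0 · V modulo a in D; the induction hypothesis applies to
    -- the difference.
    have h2 := ih hy1 (F := (MvPolynomial.finSuccEquiv S n F).coeff (m 0) - MvPolynomial.C (y 0) * V)
      (G := (MvPolynomial.finSuccEquiv S n G).coeff (m 0) + U) (by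
        have h3 : evalFractions K a (Fin.tail y) U * algebraMap S K a +
          evalFractions K a (Fin.tail y) V * algebraMap S K (y 0) =
          evalFractions K a (Fin.tail y) (H.coeff (m 0)) := congrArg Subtype.val huv
        have hC : ∀ c, evalFractions K a (Fin.tail y) (MvPolynomial.C c) = algebraMap S K c :=
          fun c => MvPolynomial.aeval_C _ _
        rw [hHc, map_sub, map_mul, hC] at h3
        rw [map_sub, map_mul, map_add, hC]
        linear_combination -h3) (Finsupp.tail m)
    rw [MvPolynomial.coeff_sub, MvPolynomial.coeff_C_mul] at h2
    have hle : Ideal.span (insert a (Set.range (Fin.tail y))) ≤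
        Ideal.span (insert a (Set.range y)) := by
      refine Ideal.span_mono (Set.insert_subset_insert ?_)
      rintro _ ⟨i, rfl⟩
      exact ⟨i.succ, rfl⟩
    have h4 := Ideal.add_mem _ (hle h2) (Ideal.mul_mem_right (MvPolynomial.coeff (Finsupp.tail m) V)
      _ (Ideal.subset_span (Set.mem_insert_of_mem a ⟨0, rfl⟩)))
    simpa using h4

end AlgebraicIndependence

/-! ### Regular systems of parameters generate chains of primes -/

section RegularSequence

variable {S : Type*} [CommRing S]

/-- The quotient has dimension at least l and its maximal ideal has l generators, so it is regular
and hence a domain. -/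
theorem isPrime_span_of_span_eq_maximalIdeal [IsRegularLocalRing S] {k l : ℕ}
    (hd : ringKrullDim S = (k + l : ℕ)) (z : Fin k → S) (w : Fin l → S)
    (h : Ideal.span (Set.range z ∪ Set.range w) = maximalIdeal S) :
    (Ideal.span (Set.range z)).IsPrime := by
  have hle : Ideal.span (Set.range z) ≤ maximalIdeal S :=
    h ▸ Ideal.span_mono Set.subset_union_left
  have := Ideal.Quotient.nontrivial_iff.mpr (ne_top_of_le_ne_top (Ideal.IsPrime.ne_top') hle)
  have : IsLocalRing (S ⧸ Ideal.span (Set.range z)) :=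
    .of_surjective' _ Ideal.Quotient.mk_surjective
  have hm : Ideal.span (Set.range fun i => Ideal.Quotient.mk (Ideal.span (Set.range z)) (w i)) =
      maximalIdeal (S ⧸ Ideal.span (Set.range z)) := by
    rw [← map_mk_maximalIdeal hle, ← h, Ideal.span_union, Ideal.map_sup, Ideal.map_quotient_self,
      bot_sup_eq, Ideal.map_span, ← Set.range_comp]
    rfl
  have hdim : (l : WithBot ℕ∞) ≤ ringKrullDim (S ⧸ Ideal.span (Set.range z)) := by
    classical
    have h1 := ringKrullDim_le_ringKrullDim_quotient_add_card (R := S) (Finset.univ.image z) (by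
      rw [IsLocalRing.ringJacobson_eq_maximalIdeal]
      intro x hx
      obtain ⟨i, -, rfl⟩ := Finset.mem_image.mp hx
      exact hle (Ideal.subset_span ⟨i, rfl⟩))
    have h2 : ((Finset.univ.image z : Finset S) : Set S) = Set.range z := by simp
    have h3 : (Finset.univ.image z).card ≤ k := Finset.card_image_le.trans (by simp)
    rw [h2, hd] at h1
    obtain ⟨e, he⟩ := exists_ringKrullDim_eq (A := S ⧸ Ideal.span (Set.range z))
    rw [he] at h1 ⊢
    have h4 : k + l ≤ e + (Finset.univ.image z).card := by exact_mod_cast h1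
    exact_mod_cast (by omega : l ≤ e)
  have := isRegularLocalRing_of_span _ hm hdim
  exact (Ideal.Quotient.isDomain_iff_prime _).mp isDomain_of_isRegularLocalRing

theorem isPrimeSequence_of_span_eq_maximalIdeal [IsRegularLocalRing S] {k l : ℕ} {a : S}
    (hd : ringKrullDim S = (k + l + 1 : ℕ)) (z : Fin k → S) (w : Fin l → S)
    (h : Ideal.span (insert a (Set.range z ∪ Set.range w)) = maximalIdeal S) :
    IsPrimeSequence a k z := by
  have hprime : (Ideal.span (insert a (Set.range z))).IsPrime := by
    have := isPrime_span_of_span_eq_maximalIdeal (k := k + 1) (l := l)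
      (by rw [hd]; congr 1; omega) (Fin.cons a z) w
      (by rw [Fin.range_cons, Set.insert_union]; exact h)
    rwa [Fin.range_cons] at this
  induction k generalizing l with
  | zero =>
    have h' : (Ideal.span {a}).IsPrime := by simpa using hprime
    exact h'
  | succ k ih =>
    have hz : Set.range z = insert (z 0) (Set.range (Fin.tail z)) := by
      conv_lhs => rw [← Fin.cons_self_tail z]
      rw [Fin.range_cons]
    have h1 : Ideal.span (insert a (Set.range (Fin.tail z) ∪
        Set.range (Fin.cons (z 0) w : Fin (l + 1) → S))) = maximalIdeal S := by
      rw [← h, hz, Fin.range_cons, Set.union_insert, Set.insert_union]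
    have hd1 : ringKrullDim S = (k + (l + 1) + 1 : ℕ) := by
      rw [hd, show k + 1 + l + 1 = k + (l + 1) + 1 by omega]
    have hp1 : (Ideal.span (insert a (Set.range (Fin.tail z)))).IsPrime := by
      have := isPrime_span_of_span_eq_maximalIdeal (k := k + 1) (l := l + 1)
        (by rw [hd]; congr 1) (Fin.cons a (Fin.tail z)) (Fin.cons (z 0) w)
        (by rw [Fin.range_cons, Set.insert_union]; exact h1)
      rwa [Fin.range_cons] at this
    -- If z 0 were redundant, the maximal ideal would have fewer generators than the dimension.
    refine ⟨ih hd1 (Fin.tail z) (Fin.cons (z 0) w) h1 hp1, fun h0 => ?_, hprime⟩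
    have h2 : Ideal.span (Set.range (Fin.cons a (Fin.append (Fin.tail z) w) :
        Fin (k + l + 1) → S)) = maximalIdeal S := by
      have hr : Set.range (Fin.append (Fin.tail z) w) =
          Set.range (Fin.tail z) ∪ Set.range w := by
        ext x
        constructor
        · rintro ⟨i, rfl⟩
          refine Fin.addCases (fun i => ?_) (fun i => ?_) i
          · rw [Fin.append_left]; exact Or.inl ⟨i, rfl⟩
          · rw [Fin.append_right]; exact Or.inr ⟨i, rfl⟩
        · rintro (⟨i, rfl⟩ | ⟨i, rfl⟩)
          · exact ⟨_, Fin.append_left _ _ i⟩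
          · exact ⟨_, Fin.append_right _ _ i⟩
      rw [Fin.range_cons, hr]
      refine le_antisymm ?_ ?_
      · rw [← h1, Fin.range_cons]
        refine Ideal.span_mono (Set.insert_subset_insert (Set.union_subset_union_right _ ?_))
        exact Set.subset_insert _ _
      · rw [← h1, Fin.range_cons, Set.union_insert, Set.insert_comm, Ideal.span_le]
        refine Set.insert_subset ?_ Ideal.subset_span
        exact Ideal.span_mono (Set.insert_subset_insert Set.subset_union_left) h0
    have h3 := ringKrullDim_le_of_span _ h2
    rw [hd] at h3
    have : k + 1 + l + 1 ≤ k + l + 1 := by exact_mod_cast h3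
    omega

end RegularSequence

/-! ### Elements of a blowup chart -/

section Chart

variable {K : Type*} [Field K] {R : Subring K} {I : Ideal R} {a : R}

theorem le_blowupChart : R ≤ blowupChart R I a := fun x hx =>
  (Algebra.adjoin R {x : K | ∃ b ∈ I, x = (b : K) / (a : K)}).algebraMap_mem ⟨x, hx⟩

theorem div_mem_blowupChart {b : R} (hb : b ∈ I) : (b : K) / a ∈ blowupChart R I a :=
  Algebra.subset_adjoin ⟨b, hb, rfl⟩

theorem blowupChart_le {B : Subring K} (hR : R ≤ B) (h : ∀ b ∈ I, (b : K) / (a : K) ∈ B) :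
    blowupChart R I a ≤ B := by
  intro x hx
  induction hx using Algebra.adjoin_induction with
  | mem x hx => obtain ⟨b, hb, rfl⟩ := hx; exact h b hb
  | algebraMap r => exact hR r.2
  | add x y _ _ hx hy => exact add_mem hx hy
  | mul x y _ _ hx hy => exact mul_mem hx hy

theorem div_pow_mem_of_mem_pow {B : Subring K} (hR : R ≤ B) (h : ∀ b ∈ I, (b : K) / (a : K) ∈ B)
    {n : ℕ} {x : R} (hx : x ∈ I ^ n) : (x : K) / (a : K) ^ n ∈ B := by
  induction hx using Submodule.pow_induction_on_left' with
  | algebraMap r => simpa using hR r.2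
  | add x y i hx hy ihx ihy =>
    rw [Subring.coe_add, add_div]; exact add_mem ihx ihy
  | mem_mul m hm i x hx ih =>
    rw [Subring.coe_mul, pow_succ', mul_div_mul_comm]
    exact mul_mem (h m hm) ih

theorem exists_eq_div_pow_of_mem_blowupChart (ha : a ∈ I) (ha0 : (a : K) ≠ 0) {x : K}
    (hx : x ∈ blowupChart R I a) : ∃ n : ℕ, ∃ f ∈ I ^ n, x = (f : K) / (a : K) ^ n := by
  induction hx using Algebra.adjoin_induction with
  | mem x hx =>
    obtain ⟨b, hb, rfl⟩ := hx
    exact ⟨1, b, by simpa using hb, by simp⟩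
  | algebraMap r => exact ⟨0, r, by simp, by simp; rfl⟩
  | add x y _ _ hx hy =>
    obtain ⟨n, f, hf, rfl⟩ := hx
    obtain ⟨k, g, hg, rfl⟩ := hy
    refine ⟨n + k, f * a ^ k + g * a ^ n, ?_, ?_⟩
    · rw [pow_add]
      refine Ideal.add_mem _ (Ideal.mul_mem_mul hf (Ideal.pow_mem_pow ha k)) ?_
      rw [mul_comm g]
      exact Ideal.mul_mem_mul (Ideal.pow_mem_pow ha n) hg
    · push_cast
      rw [pow_add]
      field_simp
  | mul x y _ _ hx hy =>
    obtain ⟨n, f, hf, rfl⟩ := hx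
    obtain ⟨k, g, hg, rfl⟩ := hy
    refine ⟨n + k, f * g, ?_, ?_⟩
    · rw [pow_add]; exact Ideal.mul_mem_mul hf hg
    · push_cast
      rw [pow_add]
      field_simp

theorem blowupChart_eq_range (ha0 : (a : K) ≠ 0) {n : ℕ} {y : Fin n → R}
    (hI : Ideal.span (insert a (Set.range y)) = I) :
    blowupChart R I a = (evalFractions K a y).range.toSubring := by
  refine le_antisymm (blowupChart_le ?_ ?_) ?_
  · intro r hr
    exact (evalFractions K a y).range.algebraMap_mem ⟨r, hr⟩
  · intro b hb
    rw [← hI] at hb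
    obtain ⟨c, hc⟩ := dvd_algebraMap_range_of_mem_span (K := K) (a := a)
      (fun h => ha0 (congrArg Subtype.val h)) hb
    have hc' : (b : K) = a * c := congrArg Subtype.val hc
    rw [hc', mul_div_cancel_left₀ _ ha0]
    exact c.2
  · rintro _ ⟨F, rfl⟩
    change evalFractions K a y F ∈ _
    induction F using MvPolynomial.induction_on with
    | C c => rw [evalFractions, MvPolynomial.aeval_C]; exact le_blowupChart c.2
    | add p q hp hq => rw [map_add]; exact add_mem hp hq
    | mul_X p i hp =>
      rw [map_mul]
      refine mul_mem hp ?_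
      rw [evalFractions, MvPolynomial.aeval_X]
      refine div_mem_blowupChart ?_
      rw [← hI]
      exact Ideal.subset_span (Set.mem_insert_of_mem _ ⟨i, rfl⟩)

end Chart

/-! ### Regularity of the blowup along the exceptional divisor -/

section RegularChart

variable {K : Type*} [Field K]

/-- The exceptional divisor is an affine space: modulo a, the chart is the polynomial ring over the
residue field in the fractions y i / a. -/
theorem isRegularRing_quotient_blowupChart {S : Subring K} [IsRegularLocalRing S] {n : ℕ}
    (hd : ringKrullDim S = (n + 1 : ℕ)) {a : S} (ha : a ∈ maximalIdeal S)
    (ha2 : a ∉ maximalIdeal S ^ 2) :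
    IsNoetherianRing (blowupChart S (maximalIdeal S) a) ∧
    IsRegularRing (blowupChart S (maximalIdeal S) a ⧸
      Ideal.span {(⟨a, le_blowupChart a.2⟩ : blowupChart S (maximalIdeal S) a)}) := by
  obtain ⟨y, hy⟩ := exists_span_insert_eq_maximalIdeal hd ha ha2
  have ha0 : a ≠ 0 := by rintro rfl; simp at ha2
  have ha0' : (a : K) ≠ 0 := fun h => ha0 (Subtype.ext h)
  have hseq : IsPrimeSequence a n y :=
    isPrimeSequence_of_span_eq_maximalIdeal (l := 0) hd y Fin.elim0 (by simpa using hy)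
  have hA := blowupChart_eq_range ha0' hy
  set A := blowupChart S (maximalIdeal S) a with hAdef
  let aA : A := ⟨a, le_blowupChart a.2⟩
  have hmem : ∀ F, evalFractions K a y F ∈ A := fun F => by rw [hA]; exact ⟨F, rfl⟩
  let ψ : MvPolynomial (Fin n) S →+* A := (evalFractions K a y).toRingHom.codRestrict A hmem
  have hψ : Function.Surjective ψ := by
    rintro ⟨x, hx⟩
    obtain ⟨F, rfl⟩ : ∃ F, evalFractions K a y F = x := by rw [hA] at hx; exact hx
    exact ⟨F, rfl⟩
  have hnoeth : IsNoetherianRing A := isNoetherianRing_of_surjective _ _ ψ hψ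
  refine ⟨hnoeth, ?_⟩
  let θ := (Ideal.Quotient.mk (Ideal.span {aA})).comp ψ
  have hθ : Function.Surjective θ := Ideal.Quotient.mk_surjective.comp hψ
  let ρ : MvPolynomial (Fin n) S →+* MvPolynomial (Fin n) (ResidueField S) :=
    MvPolynomial.map (residue S)
  have hρ : Function.Surjective ρ := MvPolynomial.map_surjective _ residue_surjective
  -- Both kernels consist of the polynomials with coefficients in the maximal ideal; for θ this is
  -- the algebraic independence modulo a.
  have hker : RingHom.ker ρ = RingHom.ker θ := by
    ext F
    have h1 : F ∈ RingHom.ker ρ ↔ ∀ m, F.coeff m ∈ Ideal.span (insert a (Set.range y)) := by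
      rw [RingHom.mem_ker, MvPolynomial.ext_iff, hy]
      refine forall_congr' fun m => ?_
      rw [MvPolynomial.coeff_map, MvPolynomial.coeff_zero, residue_eq_zero_iff]
    have h2 : F ∈ RingHom.ker θ ↔ aA ∣ ψ F := by
      rw [RingHom.mem_ker, RingHom.comp_apply, Ideal.Quotient.eq_zero_iff_mem,
        Ideal.mem_span_singleton]
    rw [h1, h2]
    constructor
    · intro hF
      obtain ⟨c, hc⟩ := dvd_range_of_coeff_mem_span (K := K) ha0 hF
      have hcA : (c : K) ∈ A := by rw [hA]; exact c.2
      have hc' : evalFractions K a y F = a * (c : K) := congrArg Subtype.val hc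
      exact ⟨⟨c, hcA⟩, Subtype.ext hc'⟩
    · rintro ⟨c, hc⟩ m
      obtain ⟨G, rfl⟩ := hψ c
      exact coeff_mem_span_of_evalFractions ha0 hseq (congrArg Subtype.val hc) m
  have e : MvPolynomial (Fin n) (ResidueField S) ≃+* (A ⧸ Ideal.span {aA}) :=
    (RingHom.quotientKerEquivOfSurjective hρ).symm.trans
      ((Ideal.quotEquivOfEq hker).trans (RingHom.quotientKerEquivOfSurjective hθ))
  exact IsRegularRing.of_ringEquiv e

/-- A_Q/a is a localization of the regular ring A/a, and regularity lifts along the nonzerodivisor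
a. -/
theorem isRegularLocalRing_ofPrime {A : Subring K} [IsNoetherianRing A] {a : A} (ha0 : a ≠ 0)
    [IsRegularRing (A ⧸ Ideal.span {a})] (Q : Ideal A) [Q.IsPrime] (ha : a ∈ Q) :
    IsRegularLocalRing (LocalSubring.ofPrime A Q).toSubring := by
  let T := (LocalSubring.ofPrime A Q).toSubring
  have : IsNoetherianRing T := IsLocalization.isNoetherianRing Q.primeCompl _ inferInstance
  let aT : T := algebraMap A T a
  have haT : aT ∈ maximalIdeal T :=
    (IsLocalization.AtPrime.to_map_mem_maximal_iff T Q a).mpr ha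
  have haT0 : aT ∈ nonZeroDivisors T := by
    rw [mem_nonZeroDivisors_iff_ne_zero]
    intro h
    have h' : (a : K) = 0 := congrArg Subtype.val h
    exact ha0 (Subtype.ext h')
  have hne : Ideal.span {aT} ≠ ⊤ := by
    rw [Ne, Ideal.span_singleton_eq_top]; exact haT
  have := Ideal.Quotient.nontrivial_iff.mpr hne
  have : IsLocalRing (T ⧸ Ideal.span {aT}) := .of_surjective' _ Ideal.Quotient.mk_surjective
  let q := Ideal.Quotient.mk (Ideal.span {a})
  let Qb : Ideal (A ⧸ Ideal.span {a}) := Q.map q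
  have hQb : Qb.IsPrime := Ideal.map_isPrime_of_surjective Ideal.Quotient.mk_surjective
    (by rw [Ideal.mk_ker]; exact (Ideal.span_singleton_le_iff_mem _).mpr ha)
  let f : (A ⧸ Ideal.span {a}) →+* (T ⧸ Ideal.span {aT}) :=
    Ideal.quotientMap _ (algebraMap A T) (by
      rw [Ideal.span_singleton_le_iff_mem, Ideal.mem_comap]
      exact Ideal.mem_span_singleton_self _)
  let := f.toAlgebra
  have hloc := IsLocalization.of_surjective (M := Q.primeCompl) (S := T) q
    Ideal.Quotient.mk_surjective (Ideal.Quotient.mk (Ideal.span {aT}))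
    Ideal.Quotient.mk_surjective rfl (by
      rw [Ideal.mk_ker, Ideal.mk_ker, Ideal.map_span, Set.image_singleton])
  have hM : Q.primeCompl.map q = Qb.primeCompl := by
    ext z
    constructor
    · rintro ⟨s, hs, rfl⟩ hz
      obtain ⟨t, ht, hts⟩ := (Ideal.mem_map_iff_of_surjective q Ideal.Quotient.mk_surjective).mp hz
      refine hs ?_
      have h1 : t - s ∈ Ideal.span {a} := Ideal.Quotient.eq.mp hts
      have h2 := (Ideal.span_singleton_le_iff_mem Q).mpr ha h1
      simpa using Q.sub_mem ht h2
    · intro hz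
      obtain ⟨s, rfl⟩ := Ideal.Quotient.mk_surjective z
      exact ⟨s, fun hs => hz (Ideal.mem_map_of_mem q hs), rfl⟩
  rw [hM] at hloc
  have := IsRegularLocalRing.of_ringEquiv (R := Localization.AtPrime Qb)
    (IsLocalization.algEquiv Qb.primeCompl (Localization.AtPrime Qb)
      (T ⧸ Ideal.span {aT})).toRingEquiv
  exact isRegularLocalRing_of_quotient haT0 haT

end RegularChart

/-! ### Local quadratic transforms and their divisors -/

section QuadraticTransform

variable {K : Type*} [Field K]

theorem ord_pow {w : K → ℤ} (hw : ∀ x y, x ≠ 0 → y ≠ 0 → w (x * y) = w x + w y) {x : K}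
    (hx : x ≠ 0) (n : ℕ) : w (x ^ n) = n * w x := by
  have h1 : w 1 = 0 := by
    have := hw 1 1 one_ne_zero one_ne_zero
    rw [one_mul] at this
    omega
  induction n with
  | zero => simpa using h1
  | succ n ih =>
    rw [pow_succ, hw _ _ (pow_ne_zero n hx) hx, ih]
    push_cast
    ring

theorem ord_inv {w : K → ℤ} (hw : ∀ x y, x ≠ 0 → y ≠ 0 → w (x * y) = w x + w y) {x : K}
    (hx : x ≠ 0) : w x⁻¹ = - w x := by
  have h1 : w 1 = 0 := by simpa using ord_pow hw one_ne_zero 0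
  have h2 := hw x x⁻¹ hx (inv_ne_zero hx)
  rw [mul_inv_cancel₀ hx, h1] at h2
  omega

/-- A discrete valuation ring is a maximal proper subring of its fraction field. -/
theorem eq_of_dvr_le {B C : Subring K} [IsDiscreteValuationRing B] [IsFractionRing B K]
    (h : B ≤ C) {z : K} (hz : z ∉ C) : C = B := by
  obtain ⟨w, hmul, hmem⟩ := exists_ord B
  refine le_antisymm (fun c hc => ?_) h
  by_contra hcB
  have hc0 : c ≠ 0 := by rintro rfl; exact hcB (zero_mem _)
  have hz0 : z ≠ 0 := by rintro rfl; exact hz (zero_mem _)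
  have hwc : w c < 0 := by
    rw [hmem c hc0] at hcB; omega
  apply hz
  -- c has a pole, so a high power of its inverse cancels the pole of z; multiplying back inside C
  -- gives z ∈ C.
  have h1 : z * c⁻¹ ^ (w z).natAbs ∈ B := by
    rw [hmem _ (mul_ne_zero hz0 (pow_ne_zero _ (inv_ne_zero hc0))),
      hmul _ _ hz0 (pow_ne_zero _ (inv_ne_zero hc0)), ord_pow hmul (inv_ne_zero hc0),
      ord_inv hmul hc0]
    have h2 : ((w z).natAbs : ℤ) * 1 ≤ ((w z).natAbs : ℤ) * -w c :=
      mul_le_mul_of_nonneg_left (by omega) (by omega)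
    omega
  have h3 : z = z * c⁻¹ ^ (w z).natAbs * c ^ (w z).natAbs := by
    rw [mul_assoc, ← mul_pow, inv_mul_cancel₀ hc0, one_pow, mul_one]
  rw [h3]
  exact mul_mem (h h1) (pow_mem hc _)

theorem inv_notMem_of_mem_maximalIdeal {S T : LocalSubring K} (h : S ≤ T) {a : S.toSubring}
    (ha : a ∈ maximalIdeal S.toSubring) (ha0 : (a : K) ≠ 0) : (a : K)⁻¹ ∉ T.toSubring := fun h' =>
  mem_maximalIdeal_iff_inv.mp ha ha0 ((le_iff_inv_mem.mp h).2 a a.2 ha0 h')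

variable {S T : LocalSubring K}

/-- Otherwise 1/a = a^n / a^(n+1) would lie in the chart and so in T, against domination. Thus
powers of a have their expected order, with no appeal to the associated graded ring. -/
theorem pow_notMem_maximalIdeal_pow (hST : S ≤ T) {a : S.toSubring}
    (ha : a ∈ maximalIdeal S.toSubring) (ha0 : (a : K) ≠ 0)
    (hT : T ∈ affineModel (blowupChart S.toSubring (maximalIdeal S.toSubring) a)) (n : ℕ) :
    a ^ n ∉ maximalIdeal S.toSubring ^ (n + 1) := by
  intro h
  apply inv_notMem_of_mem_maximalIdeal hST ha ha0
  apply le_of_mem_affineModel hT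
  have h1 := div_pow_mem_of_mem_pow (a := a) le_blowupChart
    (fun b hb => div_mem_blowupChart hb) h
  have h2 : ((a ^ n : S.toSubring) : K) / (a : K) ^ (n + 1) = (a : K)⁻¹ := by
    push_cast
    rw [pow_succ]
    field_simp
  rwa [h2] at h1

/-- A local quadratic transform of a regular local ring is regular. -/
theorem IsLocalQuadraticTransform.isRegularLocalRing [IsRegularLocalRing S.toSubring]
    (h : IsLocalQuadraticTransform S T) : IsRegularLocalRing T.toSubring := by
  obtain ⟨⟨a, ha, ha0, hT⟩, hST⟩ := h
  have ha0' : (a : K) ≠ 0 := fun h => ha0 (Subtype.ext h)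
  have ha2 : a ∉ maximalIdeal S.toSubring ^ 2 := by
    simpa using pow_notMem_maximalIdeal_pow hST ha ha0' hT 1
  obtain ⟨d, hd⟩ := exists_ringKrullDim_eq (A := S.toSubring)
  obtain ⟨n, rfl⟩ : ∃ n, d = n + 1 := by
    refine Nat.exists_eq_succ_of_ne_zero ?_
    rintro rfl
    have := IsLocalRing.isField_iff_maximalIdeal_eq.mp
      (isField_of_ringKrullDim_eq_zero (A := S.toSubring) (by simpa using hd))
    rw [this] at ha
    exact ha0 (by simpa using ha)
  obtain ⟨hn, hr⟩ := isRegularRing_quotient_blowupChart hd ha ha2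
  have hinv : (a : K)⁻¹ ∉ T.toSubring := inv_notMem_of_mem_maximalIdeal hST ha ha0'
  obtain ⟨Q, hQ, rfl⟩ := hT
  refine isRegularLocalRing_ofPrime
    (a := (⟨a, le_blowupChart a.2⟩ : blowupChart S.toSubring (maximalIdeal S.toSubring) a))
    (fun h => ha0' (congrArg Subtype.val h)) Q ?_
  by_contra haQ
  exact hinv ((inv_mem_ofPrime_iff (P := Q) ha0').mpr haQ)

theorem mem_ordRing_iff {V : ValuationSubring K} (hV : (V : Set K) = ordRing S) {x : K} :
    x ∈ V.toSubring ↔ x ∈ ordRing S := by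
  rw [← hV]; rfl

/-- The discrete valuation rings among the localizations of a local quadratic transform of `S` are
the one of `ord_S` and localizations of `S`. -/
theorem IsLocalQuadraticTransform.eq_or_mem_affineModel [IsFractionRing S.toSubring K]
    (h : IsLocalQuadraticTransform S T) {V : ValuationSubring K} (hVd : IsDiscreteValuationRing V)
    (hV : (V : Set K) = ordRing S) {W : LocalSubring K} (hW : W ∈ affineModel T.toSubring)
    (hWd : IsDiscreteValuationRing W.toSubring) :
    W = V.toLocalSubring ∨ W ∈ affineModel S.toSubring := by
  obtain ⟨⟨a, ha, ha0, hT⟩, hST⟩ := h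
  have ha0' : (a : K) ≠ 0 := fun h => ha0 (Subtype.ext h)
  have hWA := mem_affineModel_trans hT hW
  have hSW : S.toSubring ≤ W.toSubring := le_blowupChart.trans (le_of_mem_affineModel hWA)
  -- If a is a unit of W, then W is off the exceptional divisor, where the chart and S have the same
  -- localizations.
  by_cases hinv : (a : K)⁻¹ ∈ W.toSubring
  · right
    rw [mem_affineModel_iff]
    refine ⟨hSW, fun x hx => ?_⟩
    obtain ⟨u, hu, v, hv, hv0, hvi, rfl⟩ := (mem_affineModel_iff.mp hWA).2 x hx
    obtain ⟨j, f, -, rfl⟩ := exists_eq_div_pow_of_mem_blowupChart ha ha0' hu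
    obtain ⟨k, g, -, rfl⟩ := exists_eq_div_pow_of_mem_blowupChart ha ha0' hv
    have hg0 : (g : K) ≠ 0 := by intro h0; simp [h0] at hv0
    refine ⟨f * (a : K) ^ k, mul_mem f.2 (pow_mem a.2 k), g * (a : K) ^ j,
      mul_mem g.2 (pow_mem a.2 j), mul_ne_zero hg0 (pow_ne_zero j ha0'), ?_, by field_simp⟩
    have h1 : ((g : K) * (a : K) ^ j)⁻¹ = ((g : K) / (a : K) ^ k)⁻¹ * (a : K)⁻¹ ^ k *
      (a : K)⁻¹ ^ j := by
      rw [inv_pow, inv_pow]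
      field_simp
    rw [h1]
    exact mul_mem (mul_mem hvi (pow_mem hinv k)) (pow_mem hinv j)
  · left
    -- On the exceptional divisor, a denominator g / a^k that is a unit of W has ord g = k exactly,
    -- so W ⊆ V; equality follows by maximality of the discrete valuation ring W.
    have hnot := pow_notMem_maximalIdeal_pow hST ha ha0' hT
    have hle : W.toSubring ≤ V.toSubring := by
      intro x hx
      obtain ⟨u, hu, v, hv, hv0, hvi, rfl⟩ := (mem_affineModel_iff.mp hWA).2 x hx
      obtain ⟨j, f, hf, rfl⟩ := exists_eq_div_pow_of_mem_blowupChart ha ha0' hu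
      obtain ⟨k, g, hg, rfl⟩ := exists_eq_div_pow_of_mem_blowupChart ha ha0' hv
      have hg0 : (g : K) ≠ 0 := by intro h0; simp [h0] at hv0
      have hgk : g ∉ maximalIdeal S.toSubring ^ (k + 1) := by
        intro hg'
        apply hinv
        have h1 := le_of_mem_affineModel hWA (div_pow_mem_of_mem_pow (a := a) le_blowupChart
          (fun b hb => div_mem_blowupChart hb) hg')
        -- If g had order above k, this product would make a invertible in W.
        have h2 : (a : K)⁻¹ = ((g : K) / (a : K) ^ k)⁻¹ * ((g : K) / (a : K) ^ (k + 1)) := by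
          rw [pow_succ]; field_simp
        rw [h2]
        exact mul_mem hvi h1
      have h1 : (f : K) / (a : K) ^ j ∈ V.toSubring := by
        refine (mem_ordRing_iff hV).mpr ⟨f, a ^ j, pow_ne_zero j ha0, by push_cast; rfl,
          fun n hn => ?_⟩
        rcases Nat.lt_or_ge j n with hjn | hjn
        · exact absurd (Ideal.pow_le_pow_right hjn hn) (hnot j)
        · exact Ideal.pow_le_pow_right hjn hf
      have h2 : (a : K) ^ k / (g : K) ∈ V.toSubring := by
        refine (mem_ordRing_iff hV).mpr ⟨a ^ k, g, fun h => hg0 (congrArg Subtype.val h),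
          by push_cast; rfl, fun n hn => ?_⟩
        rcases Nat.lt_or_ge k n with hkn | hkn
        · exact absurd (Ideal.pow_le_pow_right hkn hn) hgk
        · exact Ideal.pow_le_pow_right hkn (Ideal.pow_mem_pow ha k)
      rw [div_div_eq_mul_div, mul_div_assoc]
      exact mul_mem h1 h2
    have := isFractionRing_of_le (K := K) hSW
    obtain ⟨z, hz⟩ : ∃ z, z ∉ V.toSubring := by
      by_contra! hall
      refine IsDiscreteValuationRing.not_isField V ⟨⟨0, 1, zero_ne_one⟩, mul_comm, fun {x} hx => ?_⟩
      exact ⟨⟨(x : K)⁻¹, hall _⟩, Subtype.ext (mul_inv_cancel₀ fun h => hx (Subtype.ext h))⟩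
    exact LocalSubring.toSubring_injective (eq_of_dvr_le hle hz).symm

/-- A nonzero finitely generated ideal becomes principal in a valuation ring. -/
theorem exists_forall_div_mem (V : ValuationSubring K) {R : Subring K} (hR : R ≤ V.toSubring)
    {I : Ideal R} (hI : I.FG) (hI0 : I ≠ ⊥) :
    ∃ a ∈ I, (a : K) ≠ 0 ∧ ∀ b ∈ I, (b : K) / (a : K) ∈ V.toSubring := by
  obtain ⟨s, hs⟩ := hI
  have hne : s.Nonempty := by
    rw [Finset.nonempty_iff_ne_empty]
    rintro rfl
    exact hI0 (by rw [← hs]; simp)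
  obtain ⟨a, has, hmax⟩ := s.exists_max_image (fun x => V.valuation (x : K)) hne
  have ha0 : (a : K) ≠ 0 := by
    intro h0
    apply hI0
    rw [← hs, Ideal.span_eq_bot]
    intro x hx
    have := hmax x hx
    rw [h0, map_zero, le_zero_iff, map_eq_zero] at this
    exact Subtype.ext this
  refine ⟨a, hs ▸ Ideal.subset_span has, ha0, fun b hb => ?_⟩
  rw [← hs] at hb
  induction hb using Submodule.span_induction with
  | mem x hx =>
    refine (V.valuation_le_one_iff _).mp ?_
    rw [map_div₀]
    exact div_le_one_of_le₀ (hmax x hx) zero_le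
  | zero => simp
  | add x y _ _ hx hy => rw [Subring.coe_add, add_div]; exact add_mem hx hy
  | smul r x _ hx =>
    rw [smul_eq_mul, Subring.coe_mul, mul_div_assoc]
    exact mul_mem (hR r.2) hx

theorem exists_isLocalQuadraticTransform_le [IsNoetherianRing S.toSubring]
    (hm : maximalIdeal S.toSubring ≠ ⊥) {V : ValuationSubring K} (hV : S ≤ V.toLocalSubring) :
    ∃ T, IsLocalQuadraticTransform S T ∧ T ≤ V.toLocalSubring := by
  obtain ⟨a, ha, ha0, hdiv⟩ := exists_forall_div_mem V hV.1 (IsNoetherian.noetherian _) hm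
  obtain ⟨T, hT, hTV⟩ := exists_mem_affineModel_le (V := V.toLocalSubring)
    (blowupChart_le hV.1 hdiv)
  refine ⟨T, ⟨⟨a, ha, fun h => ha0 (congrArg Subtype.val h), hT⟩, ?_⟩, hTV⟩
  rw [le_iff_inv_mem] at hV ⊢
  exact ⟨le_blowupChart.trans (le_of_mem_affineModel hT),
    fun x hx hx0 hxT => hV.2 x hx hx0 (hTV.1 hxT)⟩

/-- Were S its own transform, its maximal ideal would be principal, generated by a, and the
dimension at most one. This makes successive blowing up of centres terminate. -/
theorem IsLocalQuadraticTransform.ne [IsNoetherianRing S.toSubring]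
    (hd : 2 ≤ ringKrullDim S.toSubring) (h : IsLocalQuadraticTransform S T) : T ≠ S := by
  rintro rfl
  obtain ⟨⟨a, ha, ha0, hT⟩, -⟩ := h
  have ha0' : (a : K) ≠ 0 := fun h => ha0 (Subtype.ext h)
  have hm : maximalIdeal T.toSubring = Ideal.span {a} := by
    refine le_antisymm (fun b hb => ?_) ((Ideal.span_singleton_le_iff_mem _).mpr ha)
    have h1 := le_of_mem_affineModel hT (div_mem_blowupChart (a := a) hb)
    refine Ideal.mem_span_singleton'.mpr ⟨⟨_, h1⟩, Subtype.ext ?_⟩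
    exact div_mul_cancel₀ _ ha0'
  have h1 := ringKrullDim_le_of_span (n := 1) (fun _ => a) (by rw [hm]; simp)
  have h2 := hd.trans h1
  exact absurd h2 (by decide)

end QuadraticTransform

/-! ### Points, divisors and completeness of the saturated model -/

section SaturatedModel

variable {K : Type*} [Field K] {R : LocalSubring K} {Γ : Set (LocalSubring K)}

theorem mem_iterate_blowupPoints_succ {n : ℕ} {T : LocalSubring K} :
    T ∈ (blowupPoints Γ)^[n + 1] (affineModel R.toSubring) ↔
      (T ∈ (blowupPoints Γ)^[n] (affineModel R.toSubring) ∧ T ∉ Γ) ∨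
      ∃ S ∈ (blowupPoints Γ)^[n] (affineModel R.toSubring), S ∈ Γ ∧
        IsLocalQuadraticTransform S T := by
  rw [Function.iterate_succ_apply']
  rfl

theorem le_of_mem_iterate_blowupPoints {n : ℕ} {T : LocalSubring K}
    (hT : T ∈ (blowupPoints Γ)^[n] (affineModel R.toSubring)) : R.toSubring ≤ T.toSubring := by
  induction n generalizing T with
  | zero => exact le_of_mem_affineModel hT
  | succ n ih =>
    rcases mem_iterate_blowupPoints_succ.mp hT with ⟨hT, -⟩ | ⟨S, hS, -, hST⟩
    · exact ih hT
    · exact (ih hS).trans hST.2.1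

theorem isRegularLocalRing_of_mem_iterate [IsRegularLocalRing R.toSubring]
    (hΓ : ∀ S ∈ Γ, IsRegularLocalRing S.toSubring) {n : ℕ} {T : LocalSubring K}
    (hT : T ∈ (blowupPoints Γ)^[n] (affineModel R.toSubring)) :
    IsRegularLocalRing T.toSubring := by
  induction n generalizing T with
  | zero =>
    obtain ⟨P, hP, rfl⟩ : T ∈ affineModel R.toSubring := hT
    have := isRegularLocalRing_localization P
    exact .of_ringEquiv (LocalSubring.ofPrimeEquiv R.toSubring P).toRingEquiv
  | succ n ih =>
    rcases mem_iterate_blowupPoints_succ.mp hT with ⟨hT, -⟩ | ⟨S, -, hS, hST⟩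
    · exact ih hT
    · have := hΓ S hS
      exact hST.isRegularLocalRing

/-- Descends the tower of blowups: at each stage W is ord_S of the blown-up point, or already a
localization of a point one stage below. -/
theorem eq_or_mem_affineModel_of_mem_iterate [IsFractionRing R.toSubring K]
    {E : Set (ValuationSubring K)}
    (hΓ : ∀ S ∈ Γ, ∃ V ∈ E, IsDiscreteValuationRing V ∧ (V : Set K) = ordRing S)
    {n : ℕ} {T : LocalSubring K} (hT : T ∈ (blowupPoints Γ)^[n] (affineModel R.toSubring))
    {W : LocalSubring K} (hW : W ∈ affineModel T.toSubring)
    (hWd : IsDiscreteValuationRing W.toSubring) :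
    W ∈ affineModel R.toSubring ∨ ∃ V ∈ E, W = V.toLocalSubring := by
  induction n generalizing T with
  | zero => exact Or.inl (mem_affineModel_trans hT hW)
  | succ n ih =>
    rcases mem_iterate_blowupPoints_succ.mp hT with ⟨hT, -⟩ | ⟨S, hS, hSΓ, hST⟩
    · exact ih hT hW
    · obtain ⟨V, hVE, hVd, hV⟩ := hΓ S hSΓ
      have := isFractionRing_of_le (K := K) (le_of_mem_iterate_blowupPoints hS)
      rcases hST.eq_or_mem_affineModel hVd hV hW hWd with h | h
      · exact Or.inr ⟨V, hVE, h⟩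
      · exact ih hS h

theorem mem_saturatedModel_of_notMem {n : ℕ} {T : LocalSubring K}
    (hT : T ∈ (blowupPoints Γ)^[n] (affineModel R.toSubring)) (hTΓ : T ∉ Γ) :
    T ∈ saturatedModel R Γ := by
  refine ⟨n, fun m hm => ?_⟩
  induction m, hm using Nat.le_induction with
  | base => exact hT
  | succ m _ ih => exact mem_iterate_blowupPoints_succ.mpr (Or.inl ⟨ih, hTΓ⟩)

/-- The saturated model of a finite set of points is complete. -/
theorem exists_mem_saturatedModel_le (hfin : Γ.Finite)
    (hΓ : ∀ S ∈ Γ, IsRegularLocalRing S.toSubring) (hd : ∀ S ∈ Γ, 2 ≤ ringKrullDim S.toSubring)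
    {V : ValuationSubring K} (hV : R.toSubring ≤ V.toSubring) :
    ∃ T ∈ saturatedModel R Γ, T ≤ V.toLocalSubring := by
  -- Descent on the number of points of Γ that dominate the centre T of V: blowing up T gives a
  -- centre that dominates T and differs from it, so T leaves the count.
  have key : ∀ k n : ℕ, ∀ T ∈ (blowupPoints Γ)^[n] (affineModel R.toSubring),
      T ≤ V.toLocalSubring → {S ∈ Γ | T ≤ S}.ncard = k →
      ∃ T ∈ saturatedModel R Γ, T ≤ V.toLocalSubring := by
    intro k
    induction k using Nat.strong_induction_on with
    | _ k ih =>
    rintro n T hT hTV rfl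
    by_cases hTΓ : T ∈ Γ
    · have := hΓ T hTΓ
      have hm : maximalIdeal T.toSubring ≠ ⊥ := by
        intro h
        have h1 := ringKrullDim_le_of_span (n := 0) (A := T.toSubring) Fin.elim0
          (by rw [h]; simp)
        exact absurd ((hd T hTΓ).trans h1) (by decide)
      obtain ⟨T', hT', hT'V⟩ := exists_isLocalQuadraticTransform_le hm hTV
      refine ih _ (Set.ncard_lt_ncard ?_ (hfin.subset (Set.sep_subset _ _))) (n + 1) T'
        (mem_iterate_blowupPoints_succ.mpr (Or.inr ⟨T, hT, hTΓ, hT'⟩)) hT'V rfl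
      refine ⟨fun S hS => ⟨hS.1, hT'.2.trans hS.2⟩, fun hsub => ?_⟩
      have h2 : T ∈ {S ∈ Γ | T' ≤ S} := hsub ⟨hTΓ, le_rfl⟩
      exact hT'.ne (hd T hTΓ) (le_antisymm h2.2 hT'.2)
    · exact ⟨T, mem_saturatedModel_of_notMem hT hTΓ, hTV⟩
  obtain ⟨T, hT, hTV⟩ := exists_mem_affineModel_le (V := V.toLocalSubring) hV
  exact key _ 0 T hT hTV rfl

end SaturatedModel

/-! ### Integral closure of ideals and valuations -/

section IntegralClosure

variable {K : Type*} [Field K] {R : Subring K}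

/-- The kernel of the constant coefficient is the ideal of positive degree in the Rees algebra. If
its image is the unit ideal, 1 is the value of a polynomial without constant term. -/
theorem exists_polynomial_of_map_eq_top {J : Ideal R} {x : K} {B : Subring K}
    (ρ : reesAlgebra J →+* B) (hρ : Function.Surjective ρ)
    (hρx : ∀ p, (ρ p : K) = Polynomial.aeval x (p : Polynomial R))
    (h : (RingHom.ker ((Polynomial.constantCoeff (R := R)).comp
      (reesAlgebra J).val.toRingHom)).map ρ = ⊤) :
    ∃ p : Polynomial R, (∀ i, p.coeff i ∈ J ^ i) ∧ p.coeff 0 = 0 ∧ Polynomial.aeval x p = 1 := by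
  have h1 : (1 : B) ∈ (RingHom.ker ((Polynomial.constantCoeff (R := R)).comp
      (reesAlgebra J).val.toRingHom)).map ρ := h ▸ trivial
  obtain ⟨p, hp, hp1⟩ := (Ideal.mem_map_iff_of_surjective ρ hρ).mp h1
  exact ⟨p, fun i => (mem_reesAlgebra_iff J p).mp p.2 i, hp, by rw [← hρx, hp1]; rfl⟩

/-- Multiplying p(1/x) = 1 by the power of x of exponent deg p gives the equation of integral
dependence. -/
theorem isIntegralOverIdeal_of_polynomial {J : Ideal R} {x : R} (hx : (x : K) ≠ 0)
    {p : Polynomial R} (hp : ∀ i, p.coeff i ∈ J ^ i) (hp0 : p.coeff 0 = 0)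
    (hp1 : Polynomial.aeval (x : K)⁻¹ p = 1) : IsIntegralOverIdeal J x := by
  refine ⟨p.natDegree, ?_, fun i => - p.coeff i, fun i _ => neg_mem (hp i), ?_⟩
  · rw [Nat.pos_iff_ne_zero]
    intro h
    rw [Polynomial.eq_C_of_natDegree_eq_zero h, hp0] at hp1
    simp at hp1
  · apply Subtype.ext
    rw [Polynomial.aeval_eq_sum_range] at hp1
    have hr : Finset.range (p.natDegree + 1) = insert 0 (Finset.Icc 1 p.natDegree) := by
      ext i; simp; omega
    rw [hr, Finset.sum_insert (by simp), hp0, zero_smul, zero_add] at hp1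
    push_cast
    have h2 : ∑ i ∈ Finset.Icc 1 p.natDegree, -(p.coeff i : K) * (x : K) ^ (p.natDegree - i) =
        - ((x : K) ^ p.natDegree * ∑ i ∈ Finset.Icc 1 p.natDegree,
          p.coeff i • (x : K)⁻¹ ^ i) := by
      rw [Finset.mul_sum, ← Finset.sum_neg_distrib]
      refine Finset.sum_congr rfl fun i hi => ?_
      have hi' := (Finset.mem_Icc.mp hi).2
      rw [Algebra.smul_def, neg_mul, pow_sub₀ _ hx hi', inv_pow]
      change -((p.coeff i : K) * _) = -(_ * ((p.coeff i : K) * _))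
      ring
    rw [h2, hp1, mul_one, add_neg_cancel]

/-- The valuative criterion for integrality over an ideal. -/
theorem isIntegralOverIdeal_of_forall_valuationSubring {J : Ideal R} {x : R}
    (h : ∀ V : ValuationSubring K, R ≤ V.toSubring →
      ∃ j ∈ J, (j : K) ≠ 0 ∧ (x : K) / (j : K) ∈ V.toSubring) : IsIntegralOverIdeal J x := by
  by_cases hx : (x : K) = 0
  · refine ⟨1, one_pos, 0, fun i _ => Ideal.zero_mem _, ?_⟩
    apply Subtype.ext
    simp [hx]
  -- The image B of the Rees algebra is R[J/x]; x is integral over J as soon as the fractions j/x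
  -- generate the unit ideal of B.
  let φ : reesAlgebra J →ₐ[R] K := (Polynomial.aeval (x : K)⁻¹).comp (reesAlgebra J).val
  let B : Subring K := φ.toRingHom.range
  let ρ : reesAlgebra J →+* B := φ.toRingHom.rangeRestrict
  have hρ : Function.Surjective ρ := RingHom.rangeRestrict_surjective _
  have hρx : ∀ p, (ρ p : K) = Polynomial.aeval (x : K)⁻¹ (p : Polynomial R) := fun p => rfl
  by_cases htop : (RingHom.ker ((Polynomial.constantCoeff (R := R)).comp
      (reesAlgebra J).val.toRingHom)).map ρ = ⊤
  · obtain ⟨p, hp, hp0, hp1⟩ := exists_polynomial_of_map_eq_top ρ hρ hρx htop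
    exact isIntegralOverIdeal_of_polynomial hx hp hp0 hp1
  · obtain ⟨M, hM, hle⟩ := Ideal.exists_le_maximal _ htop
    -- In this V every j/x with j ∈ J is a nonunit or zero, whereas by hypothesis some x/j lies in
    -- V.
    obtain ⟨V, hV⟩ := LocalSubring.exists_le_valuationSubring (LocalSubring.ofPrime B M)
    have hRB : R ≤ B := fun r hr => ⟨algebraMap R _ ⟨r, hr⟩, by
      simp [φ]; rfl⟩
    obtain ⟨j, hj, hj0, hjV⟩ := h V (hRB.trans ((LocalSubring.le_ofPrime B M).trans hV.1))
    let q : reesAlgebra J :=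
      ⟨Polynomial.monomial 1 j, reesAlgebra.monomial_mem.mpr (by simpa using hj)⟩
    have hq : (ρ q : K) = (j : K) / x := by
      rw [hρx]
      simp [q, Polynomial.aeval_monomial, div_eq_mul_inv]
      exact Or.inl rfl
    have hqM : ρ q ∈ M := by
      refine hle (Ideal.mem_map_of_mem ρ ?_)
      rw [RingHom.mem_ker]
      change Polynomial.constantCoeff (Polynomial.monomial 1 j) = 0
      simp
    have hq0 : (ρ q : K) ≠ 0 := by rw [hq]; exact div_ne_zero hj0 hx
    refine ((inv_mem_ofPrime_iff hq0).mp ?_ hqM).elim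
    refine (le_iff_inv_mem.mp hV).2 _ (LocalSubring.le_ofPrime B M (ρ q).2) hq0 ?_
    rw [hq, inv_div]
    exact hjV

variable {I : Ideal R} {a : R}

/-- The hypotheses say IB = aB, so IⁿB is generated by aⁿ. -/
theorem exists_mem_extendIdeal_pow_iff {B : Subring K} (hR : R ≤ B) (ha : a ∈ I) (ha0 : (a : K) ≠ 0)
    (h : ∀ b ∈ I, (b : K) / (a : K) ∈ B) {n : ℕ} {x : K} :
    (∃ y ∈ extendIdeal (I ^ n) B, (y : K) = x) ↔ x / (a : K) ^ n ∈ B := by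
  constructor
  · rintro ⟨y, hy, rfl⟩
    induction hy using Submodule.span_induction with
    | mem s hs =>
      obtain ⟨r, hr, hrs⟩ := hs
      rw [← hrs]
      exact div_pow_mem_of_mem_pow hR h hr
    | zero => simp
    | add x y _ _ hx hy => rw [Subring.coe_add, add_div]; exact add_mem hx hy
    | smul r x _ hx =>
      rw [smul_eq_mul, Subring.coe_mul, mul_div_assoc]
      exact mul_mem r.2 hx
  · intro hx
    refine ⟨⟨_, hx⟩ * ⟨(a : K) ^ n, pow_mem (hR a.2) n⟩, Ideal.mul_mem_left _ _
      (Ideal.subset_span ⟨a ^ n, Ideal.pow_mem_pow ha n, by push_cast; rfl⟩), ?_⟩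
    exact div_mul_cancel₀ _ (pow_ne_zero n ha0)

/-- Put z = x / aⁿ. If z ∉ V, then 1/z ∈ V, and the integral equation divided by z^(N-1) writes z as
a polynomial in 1/z over V. -/
theorem div_pow_mem_of_isIntegralOverIdeal {V : ValuationSubring K} (hR : R ≤ V.toSubring)
    (ha0 : (a : K) ≠ 0) (h : ∀ b ∈ I, (b : K) / (a : K) ∈ V.toSubring) {n : ℕ} {x : R}
    (hx : IsIntegralOverIdeal (I ^ n) x) : (x : K) / (a : K) ^ n ∈ V.toSubring := by
  obtain ⟨N, hN, c, hc, heq⟩ := hx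
  by_contra hz
  have hx0 : (x : K) ≠ 0 := fun h0 => hz (by rw [h0, zero_div]; exact zero_mem _)
  have hA0 : (a : K) ^ n ≠ 0 := pow_ne_zero n ha0
  have hzi : (a : K) ^ n / (x : K) ∈ V.toSubring := by
    rw [← inv_div]
    exact (V.mem_or_inv_mem _).resolve_left hz
  apply hz
  have heq' := congrArg Subtype.val heq
  push_cast at heq'
  rw [add_eq_zero_iff_eq_neg] at heq'
  have h1 : (x : K) / (a : K) ^ n = - ∑ i ∈ Finset.Icc 1 N,
      ((c i : K) / (a : K) ^ (n * i)) * ((a : K) ^ n / (x : K)) ^ (i - 1) := by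
    have h2 : (x : K) / (a : K) ^ n = (x : K) ^ N / ((a : K) ^ n * (x : K) ^ (N - 1)) := by
      obtain ⟨M, rfl⟩ : ∃ M, N = M + 1 := ⟨N - 1, by omega⟩
      rw [Nat.add_sub_cancel, pow_succ]
      field_simp
    rw [h2, heq', neg_div, Finset.sum_div]
    congr 1
    refine Finset.sum_congr rfl fun i hi => ?_
    obtain ⟨hi1, hi2⟩ := Finset.mem_Icc.mp hi
    obtain ⟨k, rfl⟩ : ∃ k, i = k + 1 := ⟨i - 1, by omega⟩
    obtain ⟨l, rfl⟩ : ∃ l, N = k + 1 + l := ⟨N - (k + 1), by omega⟩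
    rw [Nat.add_sub_cancel_left, Nat.add_sub_cancel, show k + 1 + l - 1 = k + l by omega,
      div_pow, ← pow_mul, mul_add, mul_one, pow_add, pow_add]
    have := pow_ne_zero (n * k) ha0
    field_simp
  rw [h1]
  refine neg_mem (sum_mem fun i hi => mul_mem ?_ (pow_mem hzi _))
  have h3 := hc i hi
  rw [← pow_mul] at h3
  exact div_pow_mem_of_mem_pow hR h h3

end IntegralClosure

/-- If the inequalities `m c ≤ v` are equivalent to the systems `m c i ≤ w i` for a finite family of
nonnegative additive functions `w i`, then `v` is proportional to one of the `w i`. -/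
theorem exists_proportional {M ι : Type*} [CommMonoid M] (E : Finset ι) {v : M → ℤ}
    {w : ι → M → ℤ} {c : ι → ℤ} {c₀ : ℤ} (hv : ∀ x y, v (x * y) = v x + v y)
    (hv0 : ∀ x, 0 ≤ v x) (hw : ∀ i ∈ E, ∀ x y, w i (x * y) = w i x + w i y)
    (hw0 : ∀ i ∈ E, ∀ x, 0 ≤ w i x) (hc : 0 < c₀)
    (key : ∀ (y : M) (m : ℕ), m * c₀ ≤ v y ↔ ∀ i ∈ E, m * c i ≤ w i y) :
    ∃ i ∈ E, 0 < c i ∧ ∀ y, v y * c i = c₀ * w i y := by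
  classical
  have hpow : ∀ u : M → ℤ, (∀ x y, u (x * y) = u x + u y) → ∀ (y : M) (n : ℕ),
      u (y ^ n) = n * u y := by
    intro u hu y n
    have h1 : u 1 = 0 := by have := hu 1 1; rw [one_mul] at this; omega
    induction n with
    | zero => simp [h1]
    | succ n ih => rw [pow_succ, hu, ih]; push_cast; ring
  lift c₀ to ℕ using hc.le
  -- `key` for y^c₀ and m = v y, where the left side is an equality.
  have hA : ∀ i ∈ E, ∀ y, v y * c i ≤ c₀ * w i y := by
    intro i hi y
    have h1 := (key (y ^ c₀) (v y).toNat).mp (by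
      rw [hpow v hv, Int.toNat_of_nonneg (hv0 y), mul_comm]) i hi
    rwa [hpow _ (hw i hi), Int.toNat_of_nonneg (hv0 y)] at h1
  by_contra! hcon
  have hex : ∀ i, ∃ y, i ∈ E → 0 < c i → v y * c i < c₀ * w i y := by
    intro i
    by_cases h : i ∈ E ∧ 0 < c i
    · obtain ⟨y, hy⟩ := hcon i h.1 h.2
      exact ⟨y, fun _ _ => lt_of_le_of_ne (hA i h.1 y) hy⟩
    · exact ⟨1, fun h1 h2 => (h ⟨h1, h2⟩).elim⟩
  choose y hy using hex
  -- If proportionality failed for each i with c i > 0, the product of the witnesses would be strict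
  -- for all of them at once.
  have hstrict : ∀ i ∈ E, 0 < c i → v (∏ j ∈ E, y j) * c i < c₀ * w i (∏ j ∈ E, y j) := by
    intro i hi hci
    rw [← Finset.mul_prod_erase E y hi, hv, hw i hi, add_mul, mul_add]
    exact add_lt_add_of_lt_of_le (hy i hi hci) (hA i hi _)
  obtain ⟨L, hL⟩ : ∃ L : ℕ, ∀ i ∈ E, c i ≤ L :=
    ⟨∑ i ∈ E, (c i).toNat, fun i hi => (Int.self_le_toNat _).trans (by
      exact_mod_cast Finset.single_le_sum (f := fun i => (c i).toNat)
        (fun _ _ => Nat.zero_le _) hi)⟩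
  set Z := ∏ j ∈ E, y j
  -- After raising to a power, the strict gaps amount to at least L ≥ c i, which leaves room for the
  -- extra 1 in m; but for v there is no such room.
  have h1 := (key (Z ^ (c₀ * L)) (L * (v Z).toNat + 1)).mpr (by
    intro i hi
    rw [hpow _ (hw i hi)]
    push_cast
    rw [Int.toNat_of_nonneg (hv0 Z)]
    have hLv : (0 : ℤ) ≤ L * v Z := mul_nonneg (Int.natCast_nonneg _) (hv0 Z)
    by_cases hci : 0 < c i
    · have h2 := mul_le_mul_of_nonneg_left (Int.add_one_le_of_lt (hstrict i hi hci))
        (Int.natCast_nonneg L)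
      linarith [hL i hi]
    · have h2 : (0 : ℤ) ≤ c₀ * L * w i Z := mul_nonneg (by positivity) (hw0 i hi Z)
      have h3 : ((L : ℤ) * v Z + 1) * c i ≤ 0 :=
        mul_nonpos_of_nonneg_of_nonpos (by linarith) (not_lt.mp hci)
      linarith)
  rw [hpow v hv] at h1
  push_cast at h1
  rw [Int.toNat_of_nonneg (hv0 Z)] at h1
  linarith

/-! ### Uniqueness of the Rees valuation rings -/

section Rees

variable {K : Type*} [Field K] {R : Subring K} {I : Ideal R}

theorem exists_ord_extendIdeal [hK : IsFractionRing R K] (hI : I.FG) (hI0 : I ≠ ⊥)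
    (V : ValuationSubring K) (hR : R ≤ V.toSubring) (hV : IsDiscreteValuationRing V) :
    ∃ (w : K → ℤ) (α : ℤ), (∀ x y, x ≠ 0 → y ≠ 0 → w (x * y) = w x + w y) ∧
      (∀ x, x ≠ 0 → (x ∈ V.toSubring ↔ 0 ≤ w x)) ∧
      ∀ (n : ℕ) (z : K), z ≠ 0 →
        ((∃ y ∈ extendIdeal (I ^ n) V.toSubring, (y : K) = z) ↔ n * α ≤ w z) := by
  have : IsDiscreteValuationRing V.toSubring := hV
  have : IsFractionRing V.toSubring K := isFractionRing_of_le hR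
  obtain ⟨w, hmul, hmem⟩ := exists_ord V.toSubring
  obtain ⟨a, ha, ha0, hdiv⟩ := exists_forall_div_mem V hR hI hI0
  refine ⟨w, w a, hmul, hmem, fun n z hz => ?_⟩
  have hp := pow_ne_zero n ha0
  rw [exists_mem_extendIdeal_pow_iff hR ha ha0 hdiv, hmem _ (div_ne_zero hz hp), div_eq_mul_inv,
    hmul _ _ hz (inv_ne_zero hp), ord_inv hmul hp, ord_pow hmul ha0]
  omega

/-- A minimal set that determines the integral closures is contained in every other one. -/
theorem subset_of_minimal [IsFractionRing R K] (hI : I.FG) (hI0 : I ≠ ⊥)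
    {E F : Set (ValuationSubring K)} (hF : Minimal (DeterminesIntegralClosures R I) F)
    (hE : DeterminesIntegralClosures R I E) : F ⊆ E := by
  intro V hV
  have hnot : ¬ DeterminesIntegralClosures R I (F \ {V}) := fun h =>
    (hF.le_of_le h Set.sdiff_subset hV).2 rfl
  -- V cannot be dropped from the minimal set F, so some x violates the condition of V alone.
  have hex : ∃ (n : ℕ) (x : R), (∀ W ∈ F, W ≠ V →
      ∃ y ∈ extendIdeal (I ^ n) W.toSubring, (y : K) = (x : K)) ∧
      ¬ ∃ y ∈ extendIdeal (I ^ n) V.toSubring, (y : K) = (x : K) := by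
    by_contra! hcon
    refine hnot ⟨hF.1.finite.sdiff, fun W hW => hF.1.le W hW.1, fun W hW => hF.1.dvr W hW.1,
      fun n x => ?_⟩
    rw [hF.1.mem_iff]
    refine ⟨fun h W hW => h W hW.1, fun h W hW => ?_⟩
    by_cases hWV : W = V
    · subst hWV
      obtain ⟨y, hy⟩ := hcon n x fun W' hW' hne => h W' ⟨hW', hne⟩
      exact ⟨y, hy⟩
    · exact h W ⟨hW, hWV⟩
  obtain ⟨n, x, hxF, hxV⟩ := hex
  have hx0 : (x : K) ≠ 0 := fun h => hxV ⟨0, Ideal.zero_mem _, h.symm⟩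
  have hdata : ∀ W : ValuationSubring K, ∃ (w : K → ℤ) (α : ℤ), W ∈ F ∪ E →
      (∀ x y, x ≠ 0 → y ≠ 0 → w (x * y) = w x + w y) ∧
      (∀ x, x ≠ 0 → (x ∈ W.toSubring ↔ 0 ≤ w x)) ∧
      ∀ (n : ℕ) (z : K), z ≠ 0 →
        ((∃ y ∈ extendIdeal (I ^ n) W.toSubring, (y : K) = z) ↔ n * α ≤ w z) := by
    intro W
    by_cases hW : W ∈ F ∪ E
    · obtain ⟨w, α, h⟩ := exists_ord_extendIdeal hI hI0 W
        (hW.elim (hF.1.le W) (hE.le W)) (hW.elim (hF.1.dvr W) (hE.dvr W))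
      exact ⟨w, α, fun _ => h⟩
    · exact ⟨0, 0, fun h => (hW h).elim⟩
  choose w α hw using hdata
  have hcoe : ∀ y : nonZeroDivisors R, ((y : R) : K) ≠ 0 := fun y h =>
    nonZeroDivisors.coe_ne_zero y (Subtype.ext h)
  -- Integrality of x^m y over I^(nm) is tested in two ways. Through F only the inequality of V
  -- matters, as x satisfies the others; through E it is a finite system. `exists_proportional`
  -- compares the two.
  have hiff : ∀ W ∈ F ∪ E, ∀ (y : nonZeroDivisors R) (m : ℕ),
      m * (n * α W - w W x) ≤ w W (y : R) ↔
        ∃ z ∈ extendIdeal (I ^ (n * m)) W.toSubring, (z : K) = ((x ^ m * y : R) : K) := by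
    intro W hW y m
    obtain ⟨h1, h2, h3⟩ := hw W hW
    push_cast
    rw [h3 _ _ (mul_ne_zero (pow_ne_zero m hx0) (hcoe y)), h1 _ _ (pow_ne_zero m hx0) (hcoe y),
      ord_pow h1 hx0, mul_sub, ← mul_assoc, Nat.cast_mul, mul_comm (n : ℤ) m]
    constructor <;> intro h <;> linarith
  have hVU : V ∈ F ∪ E := Or.inl hV
  have hnn : ∀ W ∈ F ∪ E, ∀ y : nonZeroDivisors R, 0 ≤ w W (y : R) := fun W hW y =>
    ((hw W hW).2.1 _ (hcoe y)).mp (hW.elim (hF.1.le W) (hE.le W) (y : R).2)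
  have hcV : 0 < n * α V - w V x := by
    rw [(hw V hVU).2.2 n x hx0] at hxV
    omega
  obtain ⟨W, hWE, hcW, hprop⟩ := exists_proportional (M := nonZeroDivisors R)
    hE.finite.toFinset (v := fun y => w V (y : R)) (w := fun W y => w W (y : R))
    (c := fun W => n * α W - w W x) (c₀ := n * α V - w V x)
    (fun y z => by push_cast; exact (hw V hVU).1 _ _ (hcoe y) (hcoe z)) (hnn V hVU)
    (fun W hW y z => by
      push_cast
      exact (hw W (Or.inr (hE.finite.mem_toFinset.mp hW))).1 _ _ (hcoe y) (hcoe z))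
    (fun W hW => hnn W (Or.inr (hE.finite.mem_toFinset.mp hW))) hcV
    (fun y m => by
      rw [hiff V hVU]
      have h1 : (∃ z ∈ extendIdeal (I ^ (n * m)) V.toSubring, (z : K) = ((x ^ m * y : R) : K)) ↔
          IsIntegralOverIdeal (I ^ (n * m)) (x ^ m * y : R) := by
        rw [hF.1.mem_iff]
        refine ⟨fun h W hW => ?_, fun h => h V hV⟩
        by_cases hWV : W = V
        · rw [hWV]; exact h
        · rw [← hiff W (Or.inl hW)]
          have h2 := hxF W hW hWV
          rw [(hw W (Or.inl hW)).2.2 n x hx0] at h2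
          exact (mul_nonpos_of_nonneg_of_nonpos (Int.natCast_nonneg m) (by linarith)).trans
            (hnn W (Or.inl hW) y)
      rw [h1, hE.mem_iff]
      refine forall_congr' fun W => ?_
      rw [hE.finite.mem_toFinset]
      exact forall_congr' fun hW => (hiff W (Or.inr hW) y m).symm)
  rw [hE.finite.mem_toFinset] at hWE
  have hWU : W ∈ F ∪ E := Or.inr hWE
  -- The orders of V and W are positively proportional on R, hence on K, so the valuation rings
  -- agree.
  suffices h : V = W by rwa [h]
  ext z
  by_cases hz : z = 0
  · rw [hz]; exact iff_of_true (zero_mem _) (zero_mem _)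
  obtain ⟨⟨a, b⟩, hab⟩ := IsLocalization.surj (nonZeroDivisors R) z
  have ha : a ∈ nonZeroDivisors R := by
    rw [mem_nonZeroDivisors_iff_ne_zero]
    rintro rfl
    rw [map_zero] at hab
    exact (mul_ne_zero hz (hcoe b)) hab
  have e1 := hprop ⟨a, ha⟩
  have e2 := hprop b
  beta_reduce at e1 e2
  have hab' : z * ((b : R) : K) = (a : K) := hab
  rw [← hab', (hw V hVU).1 _ _ hz (hcoe b), (hw W hWU).1 _ _ hz (hcoe b)] at e1
  have e3 : w V z * (n * α W - w W x) = (n * α V - w V x) * w W z := by linarith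
  change z ∈ V.toSubring ↔ z ∈ W.toSubring
  rw [(hw V hVU).2.1 z hz, (hw W hWU).2.1 z hz, ← mul_nonneg_iff_of_pos_right hcW, e3,
    mul_nonneg_iff_of_pos_left hcV]

end Rees

/-! ### Rees valuation rings on normal complete models -/

section ModelsAndRees

variable {K : Type*} [Field K]

theorem exists_valuationSubring_eq (W : LocalSubring K) [IsDiscreteValuationRing W.toSubring]
    [IsFractionRing W.toSubring K] : ∃ V : ValuationSubring K, V.toLocalSubring = W := by
  obtain ⟨w, hmul, hmem⟩ := exists_ord W.toSubring
  refine ⟨⟨W.toSubring, fun x => ?_⟩, LocalSubring.ext rfl⟩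
  by_cases hx : x = 0
  · exact Or.inl (hx ▸ zero_mem W.toSubring)
  rcases le_total 0 (w x) with h | h
  · exact Or.inl ((hmem x hx).mpr h)
  · exact Or.inr ((hmem _ (inv_ne_zero hx)).mpr (by rw [ord_inv hmul hx]; omega))

theorem IsModel.exists_affineModel {R : Subring K} [IsNoetherianRing R] {Y : Set (LocalSubring K)}
    (hY : IsModel R Y) {S : LocalSubring K} (hS : S ∈ Y) :
    ∃ A : Subring K, R ≤ A ∧ IsNoetherianRing A ∧ S ∈ affineModel A ∧ affineModel A ⊆ Y := by
  obtain ⟨F, -, hFG, rfl⟩ := hY.finite_union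
  obtain ⟨A, hA, hSA⟩ := Set.mem_iUnion₂.mp hS
  refine ⟨A.toSubring, fun r hr => A.algebraMap_mem ⟨r, hr⟩, ?_, hSA,
    Set.subset_biUnion_of_mem (u := fun A : Subalgebra R K => affineModel A.toSubring) hA⟩
  have : Algebra.FiniteType R A := (Subalgebra.fg_iff_finiteType A).mp (hFG A hA)
  exact Algebra.FiniteType.isNoetherianRing R A

theorem IsModel.le {R : Subring K} [IsNoetherianRing R] {Y : Set (LocalSubring K)}
    (hY : IsModel R Y) {S : LocalSubring K} (hS : S ∈ Y) : R ≤ S.toSubring := by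
  obtain ⟨A, hRA, -, hSA, -⟩ := hY.exists_affineModel hS
  exact hRA.trans (le_of_mem_affineModel hSA)

theorem IsModel.isNoetherianRing {R : Subring K} [IsNoetherianRing R] {Y : Set (LocalSubring K)}
    (hY : IsModel R Y) {S : LocalSubring K} (hS : S ∈ Y) : IsNoetherianRing S.toSubring := by
  obtain ⟨A, -, hA, hSA, -⟩ := hY.exists_affineModel hS
  exact isNoetherianRing_of_mem_affineModel hSA

theorem IsModel.mem_of_mem_affineModel {R : Subring K} [IsNoetherianRing R]
    {Y : Set (LocalSubring K)} (hY : IsModel R Y) {S W : LocalSubring K} (hS : S ∈ Y)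
    (hW : W ∈ affineModel S.toSubring) : W ∈ Y := by
  obtain ⟨A, -, -, hSA, hAY⟩ := hY.exists_affineModel hS
  exact hAY (mem_affineModel_trans hSA hW)

variable {R : Subring K} {I : Ideal R}

theorem HasMorphism.exists_forall_div_mem {Y : Set (LocalSubring K)}
    (h : HasMorphism Y (normalizedBlowup R I)) {S : LocalSubring K} (hS : S ∈ Y) :
    ∃ a ∈ I, (a : K) ≠ 0 ∧ ∀ b ∈ I, (b : K) / (a : K) ∈ S.toSubring := by
  obtain ⟨S', ⟨a, ha, ha0, hS'⟩, hle⟩ := h S hS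
  refine ⟨a, ha, fun h => ha0 (Subtype.ext h), fun b hb => hle.1 (le_of_mem_affineModel hS' ?_)⟩
  exact (integralClosure (blowupChart R I a) K).algebraMap_mem ⟨_, div_mem_blowupChart hb⟩

/-- A discrete valuation ring `A_P` in which a nonzero ideal generated by elements of `R` is proper
is the localization of `A` at a minimal prime of that ideal. -/
theorem mem_minimalPrimes_extendIdeal {A : Subring K} (hRA : R ≤ A) [IsFractionRing A K]
    {P : Ideal A} [P.IsPrime]
    (hd : IsDiscreteValuationRing (LocalSubring.ofPrime A P).toSubring) (hI0 : I ≠ ⊥)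
    (h : ∀ b ∈ I, (b : K) ≠ 0 → (b : K)⁻¹ ∉ (LocalSubring.ofPrime A P).toSubring) :
    P ∈ (extendIdeal I A).minimalPrimes := by
  have : IsFractionRing (LocalSubring.ofPrime A P).toSubring K :=
    isFractionRing_of_le (LocalSubring.le_ofPrime A P)
  obtain ⟨w, hmul, hmem⟩ := exists_ord (LocalSubring.ofPrime A P).toSubring
  obtain ⟨b, hb, hb0⟩ := Submodule.exists_mem_ne_zero_of_ne_bot hI0
  have hb0' : (b : K) ≠ 0 := fun h => hb0 (Subtype.ext h)
  refine ⟨⟨inferInstance, Ideal.span_le.mpr ?_⟩, ?_⟩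
  · rintro s ⟨r, hr, hrs⟩
    by_cases hs0 : (s : K) = 0
    · rw [show s = 0 from Subtype.ext hs0]; exact P.zero_mem
    · have h1 := h r hr (hrs ▸ hs0)
      rw [hrs, inv_mem_ofPrime_iff hs0, not_not] at h1
      exact h1
  · rintro Q ⟨hQ, hJQ⟩ hQP z hz
    by_cases hz0 : (z : K) = 0
    · rw [show z = 0 from Subtype.ext hz0]; exact Q.zero_mem
    have hzw : 0 < w z := by
      have h1 : (z : K)⁻¹ ∉ (LocalSubring.ofPrime A P).toSubring := fun h1 =>
        (inv_mem_ofPrime_iff hz0).mp h1 hz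
      rw [hmem _ (inv_ne_zero hz0), ord_inv hmul hz0] at h1
      omega
    have hbw : 0 ≤ w b := (hmem _ hb0').mp (LocalSubring.le_ofPrime A P (hRA b.2))
    -- As w z ≥ 1, this power of z has order at least w b. Hence a multiple of it by some s ∉ P lies
    -- in IA ⊆ Q, and Q ⊆ P forces z ∈ Q.
    have hk : (z : K) ^ (w b).toNat / (b : K) ∈ (LocalSubring.ofPrime A P).toSubring := by
      have hp := pow_ne_zero (w b).toNat hz0
      rw [hmem _ (div_ne_zero hp hb0'), div_eq_mul_inv, hmul _ _ hp (inv_ne_zero hb0'),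
        ord_inv hmul hb0', ord_pow hmul hz0, Int.toNat_of_nonneg hbw]
      nlinarith
    obtain ⟨c, s, hs, hcs⟩ := mem_ofPrime_iff.mp hk
    have hs0 : (s : K) ≠ 0 := fun h0 => hs (by
      rw [show s = 0 from Subtype.ext h0]; exact P.zero_mem)
    have heq : s * z ^ (w b).toNat = c * ⟨b, hRA b.2⟩ := by
      apply Subtype.ext
      push_cast
      rw [div_eq_div_iff hb0' hs0] at hcs
      rw [mul_comm, hcs]
    have hmemQ : s * z ^ (w b).toNat ∈ Q := by
      rw [heq]
      exact Q.mul_mem_left _ (hJQ (Ideal.subset_span ⟨b, hb, rfl⟩))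
    exact hQ.mem_of_pow_mem _ ((hQ.mem_or_mem hmemQ).resolve_left fun h => hs (hQP h))

/-- The model has finitely many Noetherian charts A, and on each such a ring is the localization at
one of the finitely many minimal primes of IA. -/
theorem IsModel.finite_setOf_dvr [IsFractionRing R K] [IsNoetherianRing R]
    {Y : Set (LocalSubring K)} (hY : IsModel R Y) (hI0 : I ≠ ⊥) :
    {V : ValuationSubring K | V.toLocalSubring ∈ Y ∧ IsDiscreteValuationRing V ∧
      ∀ b ∈ I, (b : K) ≠ 0 → (b : K)⁻¹ ∉ V.toSubring}.Finite := by
  obtain ⟨F, hF, hFG, rfl⟩ := hY.finite_union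
  have hfin : (⋃ A ∈ F, (fun p : PrimeSpectrum A => LocalSubring.ofPrime A.toSubring p.asIdeal) ''
      {p | p.asIdeal ∈ (extendIdeal I A.toSubring).minimalPrimes}).Finite := by
    refine hF.biUnion fun A hA => Set.Finite.image _ ?_
    have : Algebra.FiniteType R A := (Subalgebra.fg_iff_finiteType A).mp (hFG A hA)
    have : IsNoetherianRing A.toSubring := Algebra.FiniteType.isNoetherianRing R A
    exact (Ideal.finite_minimalPrimes_of_isNoetherianRing _ _).preimage
      (fun p _ q _ hpq => PrimeSpectrum.ext hpq)
  refine Set.Finite.subset (hfin.preimage (f := ValuationSubring.toLocalSubring)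
    fun V _ W _ h => ?_) ?_
  · exact ValuationSubring.toLocalSubring_injective h
  · rintro V ⟨hVY, hVd, hVI⟩
    obtain ⟨A, hA, P, hP, hVA⟩ := Set.mem_iUnion₂.mp hVY
    refine Set.mem_iUnion₂.mpr ⟨A, hA, ⟨P, hP⟩, ?_, hVA.symm⟩
    have hRA : R ≤ A.toSubring := fun r hr => A.algebraMap_mem ⟨r, hr⟩
    have : IsFractionRing A.toSubring K := isFractionRing_of_le hRA
    have hVs : V.toSubring = (LocalSubring.ofPrime A.toSubring P).toSubring :=
      congrArg LocalSubring.toSubring hVA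
    refine mem_minimalPrimes_extendIdeal hRA ?_ hI0 (hVs ▸ hVI)
    have : IsDiscreteValuationRing V.toSubring := hVd
    rwa [hVs] at this

/-- The discrete valuation rings on a normal complete model lying over the normalized blowup of
`I` in which `I` is proper determine the integral closures of the powers of `I`. -/
theorem IsCompleteModel.determinesIntegralClosures [IsFractionRing R K] [IsNoetherianRing R]
    {Y : Set (LocalSubring K)} (hY : IsCompleteModel R Y) (hYn : IsNormalModel Y)
    (hh : HasMorphism Y (normalizedBlowup R I)) (hI0 : I ≠ ⊥) :
    DeterminesIntegralClosures R I {V : ValuationSubring K | V.toLocalSubring ∈ Y ∧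
      IsDiscreteValuationRing V ∧ ∀ b ∈ I, (b : K) ≠ 0 → (b : K)⁻¹ ∉ V.toSubring} where
  finite := hY.finite_setOf_dvr hI0
  le V hV := hY.le hV.1
  dvr V hV := hV.2.1
  mem_iff n x := by
    constructor
    · intro hx V hV
      have hR : R ≤ V.toSubring := hY.le hV.1
      obtain ⟨a, ha, ha0, hdiv⟩ := ZariskiModel.exists_forall_div_mem V hR
        (IsNoetherian.noetherian I) hI0
      exact (exists_mem_extendIdeal_pow_iff hR ha ha0 hdiv).mpr
        (div_pow_mem_of_isIntegralOverIdeal hR ha0 hdiv hx)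
    · intro hx
      -- At the centre S of V on Y one has IS = aS. It suffices that x / aⁿ lies in S, which is
      -- tested in the discrete valuation localizations of the normal ring S.
      refine isIntegralOverIdeal_of_forall_valuationSubring fun V hV => ?_
      obtain ⟨S, hS, hSV⟩ := hY.complete V hV
      obtain ⟨a, ha, ha0, hdiv⟩ := hh.exists_forall_div_mem hS
      refine ⟨a ^ n, Ideal.pow_mem_pow ha n, by push_cast; exact pow_ne_zero n ha0, hSV.1 ?_⟩
      have hRS := hY.le hS
      have := hY.isNoetherianRing hS
      have := hYn S hS
      have : IsFractionRing S.toSubring K := isFractionRing_of_le hRS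
      push_cast
      refine mem_of_forall_dvr fun W hW hWd => ?_
      have hSW := le_of_mem_affineModel hW
      by_cases hWI : ∀ b ∈ I, (b : K) ≠ 0 → (b : K)⁻¹ ∉ W.toSubring
      · have : IsFractionRing W.toSubring K := isFractionRing_of_le hSW
        obtain ⟨V', rfl⟩ := exists_valuationSubring_eq W
        exact (exists_mem_extendIdeal_pow_iff (hRS.trans hSW) ha ha0
          fun b hb => hSW (hdiv b hb)).mp
            (hx V' ⟨hY.mem_of_mem_affineModel hS hW, hWd, hWI⟩)
      -- Where I becomes the unit ideal, a is a unit: 1/a = (b/a)(1/b).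
      · push Not at hWI
        obtain ⟨b, hb, hb0, hbW⟩ := hWI
        rw [div_eq_mul_inv, ← inv_pow]
        refine mul_mem (hSW (hRS x.2)) (pow_mem ?_ n)
        have h1 := mul_mem (hSW (hdiv b hb)) hbW
        rwa [div_mul_eq_mul_div, mul_inv_cancel₀ hb0, one_div] at h1

/-- The Rees valuation rings of `I` lie on every normal complete model over the normalized blowup
of `I`. -/
theorem IsCompleteModel.mem_of_mem_reesValuationRings [IsFractionRing R K] [IsNoetherianRing R]
    {Y : Set (LocalSubring K)} (hY : IsCompleteModel R Y) (hYn : IsNormalModel Y)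
    (hh : HasMorphism Y (normalizedBlowup R I)) (hI0 : I ≠ ⊥) {V : ValuationSubring K}
    (hV : V ∈ reesValuationRings R I) : V.toLocalSubring ∈ Y ∧ IsDiscreteValuationRing V := by
  obtain ⟨F, hF, hVF⟩ := hV
  have := subset_of_minimal (IsNoetherian.noetherian I) hI0 hF
    (hY.determinesIntegralClosures hYn hh hI0) hVF
  exact ⟨this.1, this.2.1⟩

end ModelsAndRees

/-! ### Divisors and torsion class groups -/

section ClassGroup

variable {A : Type*} [CommRing A] [IsDomain A]

theorem algebraMap_atPrime_ne_zero (P : HeightOnePrime A) {a : A} (ha : a ≠ 0) :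
    algebraMap A (Localization.AtPrime P.1.asIdeal) a ≠ 0 := fun h =>
  ha ((injective_iff_map_eq_zero _).mp (IsLocalization.injective _
    P.1.asIdeal.primeCompl_le_nonZeroDivisors) a h)

theorem mem_maximalIdeal_pow_iff {B : Type*} [CommRing B] [IsDomain B] [IsDiscreteValuationRing B]
    {x : B} {n : ℕ} : x ∈ maximalIdeal B ^ n ↔ n ≤ IsDiscreteValuationRing.addVal B x := by
  obtain ⟨ϖ, hϖ⟩ := IsDiscreteValuationRing.exists_irreducible B
  rw [hϖ.maximalIdeal_eq, Ideal.span_singleton_pow, Ideal.mem_span_singleton,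
    ← IsDiscreteValuationRing.addVal_le_iff_dvd, hϖ.addVal_pow]

variable [IsNoetherianRing A] [IsIntegrallyClosed A]

theorem HeightOnePrime.isDiscreteValuationRing (P : HeightOnePrime A) :
    IsDiscreteValuationRing (Localization.AtPrime P.1.asIdeal) :=
  isDiscreteValuationRing_of_height_one P.1.asIdeal P.2 _

/-- For a ≠ 0 the supremum defining `ordAt` is over a bounded initial segment, so the default value
of `sSup` on unbounded sets plays no role. -/
theorem coe_ordAt (P : HeightOnePrime A) {a : A} (ha : a ≠ 0) :
    have := P.isDiscreteValuationRing
    (ordAt P a : ℕ∞) = IsDiscreteValuationRing.addVal (Localization.AtPrime P.1.asIdeal)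
      (algebraMap A _ a) := by
  intro _
  have h0 := algebraMap_atPrime_ne_zero P ha
  obtain ⟨k, hk⟩ := ENat.ne_top_iff_exists.mp
    (mt IsDiscreteValuationRing.addVal_eq_top_iff.mp h0)
  have h1 : {n : ℕ | algebraMap A (Localization.AtPrime P.1.asIdeal) a ∈
      maximalIdeal (Localization.AtPrime P.1.asIdeal) ^ n} = Set.Iic k := by
    ext n
    rw [Set.mem_ofPred_eq, mem_maximalIdeal_pow_iff, ← hk, Nat.cast_le, Set.mem_Iic]
  rw [ordAt, h1, csSup_Iic, hk]

theorem ordAt_mul (P : HeightOnePrime A) {a b : A} (ha : a ≠ 0) (hb : b ≠ 0) :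
    ordAt P (a * b) = ordAt P a + ordAt P b := by
  have := P.isDiscreteValuationRing
  have h : ((ordAt P (a * b) : ℕ) : ℕ∞) = (ordAt P a + ordAt P b : ℕ) := by
    rw [Nat.cast_add, coe_ordAt P ha, coe_ordAt P hb, coe_ordAt P (mul_ne_zero ha hb), map_mul,
      IsDiscreteValuationRing.addVal_mul]
  exact_mod_cast h

theorem mem_iff_ordAt_pos (P : HeightOnePrime A) {a : A} (ha : a ≠ 0) :
    a ∈ P.1.asIdeal ↔ 0 < ordAt P a := by
  have := P.isDiscreteValuationRing
  rw [← IsLocalization.AtPrime.to_map_mem_maximal_iff (Localization.AtPrime P.1.asIdeal)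
      P.1.asIdeal,
    ← pow_one (maximalIdeal _), mem_maximalIdeal_pow_iff, ← coe_ordAt P ha]
  norm_cast

theorem dvd_of_forall_ordAt_le {a b : A} (ha : a ≠ 0) (hb : b ≠ 0)
    (h : ∀ P : HeightOnePrime A, ordAt P b ≤ ordAt P a) : b ∣ a := by
  by_contra hab
  obtain ⟨P, hP, hP1, hs⟩ := exists_height_one_of_not_dvd hb hab
  let Q : HeightOnePrime A := ⟨⟨P, hP⟩, hP1⟩
  have := Q.isDiscreteValuationRing
  have h1 : ((ordAt Q b : ℕ) : ℕ∞) ≤ (ordAt Q a : ℕ) := Nat.cast_le.mpr (h Q)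
  rw [coe_ordAt Q hb, coe_ordAt Q ha, IsDiscreteValuationRing.addVal_le_iff_dvd] at h1
  obtain ⟨z, hz⟩ := h1
  obtain ⟨⟨c, s⟩, hcs⟩ := IsLocalization.surj P.primeCompl z
  refine hs s s.2 ⟨c, ?_⟩
  apply IsLocalization.injective (Localization.AtPrime P) P.primeCompl_le_nonZeroDivisors
  rw [map_mul, map_mul]
  change _ = algebraMap A (Localization.AtPrime P) b * z at hz
  change z * _ = _ at hcs
  change _ * algebraMap A (Localization.AtPrime P) a = _
  change algebraMap A (Localization.AtPrime P) a = _ at hz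
  rw [hz, ← hcs]
  ring

/-- The generators already form a group, since orders are additive. -/
theorem exists_of_mem_principalDivisors {D : HeightOnePrime A →₀ ℤ}
    (hD : D ∈ principalDivisors A) : ∃ a b : A, a ≠ 0 ∧ b ≠ 0 ∧
      ∀ P : HeightOnePrime A, D P = (ordAt P a : ℤ) - (ordAt P b : ℤ) := by
  induction hD using AddSubgroup.closure_induction with
  | mem D h => exact h
  | zero => exact ⟨1, 1, one_ne_zero, one_ne_zero, fun P => by simp⟩
  | add D D' _ _ h h' =>
    obtain ⟨a, b, ha, hb, h⟩ := h
    obtain ⟨a', b', ha', hb', h'⟩ := h'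
    refine ⟨a * a', b * b', mul_ne_zero ha ha', mul_ne_zero hb hb', fun P => ?_⟩
    rw [ordAt_mul P ha ha', ordAt_mul P hb hb', Finsupp.add_apply, h, h']
    push_cast
    ring
  | neg D _ h =>
    obtain ⟨a, b, ha, hb, h⟩ := h
    exact ⟨b, a, hb, ha, fun P => by rw [Finsupp.neg_apply, h, neg_sub]⟩

/-- If the divisor class group is torsion, then each height one prime is the only height one prime
that contains a suitable element. -/
theorem HasTorsionDivisorClassGroup.exists_mem_iff (h : HasTorsionDivisorClassGroup A)
    (P : HeightOnePrime A) :
    ∃ c : A, c ≠ 0 ∧ ∀ Q : HeightOnePrime A, c ∈ Q.1.asIdeal ↔ Q = P := by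
  classical
  obtain ⟨n, hn, hnP⟩ := isOfFinAddOrder_iff_nsmul_eq_zero.mp
    (h (QuotientAddGroup.mk (Finsupp.single P (1 : ℤ))))
  rw [← QuotientAddGroup.mk_nsmul, QuotientAddGroup.eq_zero_iff] at hnP
  obtain ⟨a, b, ha, hb, hab⟩ := exists_of_mem_principalDivisors hnP
  have hab' : ∀ Q : HeightOnePrime A, (if Q = P then (n : ℤ) else 0) = ordAt Q a - ordAt Q b := by
    intro Q
    rw [← hab, Finsupp.smul_apply, Finsupp.single_apply]
    by_cases hQ : Q = P
    · simp [hQ]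
    · simp [hQ, Ne.symm hQ]
  -- Some positive multiple nP equals div(a/b). It is effective, so a/b is an element c of A, and
  -- its divisor is nP.
  obtain ⟨c, rfl⟩ : b ∣ a := dvd_of_forall_ordAt_le ha hb fun Q => by
    have := hab' Q
    split_ifs at this <;> omega
  have hc : c ≠ 0 := right_ne_zero_of_mul ha
  refine ⟨c, hc, fun Q => ?_⟩
  have := hab' Q
  rw [ordAt_mul Q hb hc] at this
  rw [mem_iff_ordAt_pos Q hc]
  split_ifs at this with hQ
  · exact iff_of_true (by push_cast at this; omega) hQ
  · exact iff_of_false (by push_cast at this; omega) hQ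

end ClassGroup

/-! ### Comparison of a point of Y with the points above it -/

section Fiber

variable {K : Type*} [Field K]

theorem height_eq_one_of_dvr {A : Subring K} {P : Ideal A} [P.IsPrime]
    (h : IsDiscreteValuationRing (LocalSubring.ofPrime A P).toSubring) : P.height = 1 := by
  have h1 := IsLocalization.AtPrime.ringKrullDim_eq_height P
    (LocalSubring.ofPrime A P).toSubring
  rw [IsDiscreteValuationRing.ringKrullDim_eq_one] at h1
  exact_mod_cast h1.symm

/-- A normal Noetherian local subring is a sublocalization of every subring of which its discrete
valuation localizations are localizations. -/
theorem isSublocalization_of_forall_dvr {A B : Subring K} [IsNoetherianRing B]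
    [IsIntegrallyClosed B] [IsFractionRing B K]
    (h : ∀ W ∈ affineModel B, IsDiscreteValuationRing W.toSubring → W ∈ affineModel A) :
    IsSublocalization A B := by
  refine ⟨{M | ∃ P : Ideal A, ∃ _ : P.IsPrime, M = P.primeCompl ∧
    LocalSubring.ofPrime A P ∈ affineModel B ∧
    IsDiscreteValuationRing (LocalSubring.ofPrime A P).toSubring}, ?_, fun x => ⟨?_, ?_⟩⟩
  · rintro M ⟨P, hP, rfl, -⟩ h0
    exact h0 P.zero_mem
  · rintro hx M ⟨P, hP, rfl, hB, -⟩
    obtain ⟨a, s, hs, hx⟩ := mem_ofPrime_iff.mp (le_of_mem_affineModel hB hx)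
    exact ⟨a, s, hs, hx⟩
  · intro hx
    refine mem_of_forall_dvr fun W hW hWd => ?_
    obtain ⟨P, hP, rfl⟩ := h W hW hWd
    obtain ⟨a, s, hs, hx⟩ := hx _ ⟨P, hP, rfl, hW, hWd⟩
    exact mem_ofPrime_iff.mpr ⟨a, s, hs, hx⟩

/-- A normal Noetherian local subring `T` dominating `S`, all of whose discrete valuation
localizations are localizations of `S`, is equal to `S` if `S` has torsion class group. -/
theorem eq_of_hasTorsionDivisorClassGroup {S T : LocalSubring K} (hST : S ≤ T)
    [IsNoetherianRing S.toSubring] [IsIntegrallyClosed S.toSubring] [IsFractionRing S.toSubring K]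
    [IsNoetherianRing T.toSubring] [IsIntegrallyClosed T.toSubring] [IsFractionRing T.toSubring K]
    (h : ∀ W ∈ affineModel T.toSubring, IsDiscreteValuationRing W.toSubring →
      W ∈ affineModel S.toSubring) (htors : HasTorsionDivisorClassGroup S.toSubring) : T = S := by
  refine LocalSubring.ext (le_antisymm (fun x hx => ?_) hST.1)
  refine mem_of_forall_dvr fun W hW hWd => ?_
  obtain ⟨P, hP, rfl⟩ := hW
  let P₁ : HeightOnePrime S.toSubring := ⟨⟨P, hP⟩, height_eq_one_of_dvr hWd⟩
  obtain ⟨c, hc0, hc⟩ := htors.exists_mem_iff P₁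
  have hc0' : (c : K) ≠ 0 := fun h => hc0 (Subtype.ext h)
  have hcS : c ∈ maximalIdeal S.toSubring := le_maximalIdeal hP.ne_top ((hc P₁).mpr rfl)
  have hcT := inv_notMem_of_mem_maximalIdeal hST hcS hc0'
  by_contra hxW
  -- Since x ∈ T is not in S_P, S_P is not a localization of T. As c lies in no other height one
  -- prime, 1/c belongs to all discrete valuation localizations of T, hence to T.
  refine hcT (mem_of_forall_dvr fun W' hW' hWd' => ?_)
  by_contra hcW'
  obtain ⟨P', hP', rfl⟩ := h W' hW' hWd'
  rw [inv_mem_ofPrime_iff hc0', not_not] at hcW'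
  have hPP : (⟨⟨P', hP'⟩, height_eq_one_of_dvr hWd'⟩ : HeightOnePrime S.toSubring) = P₁ :=
    (hc _).mp hcW'
  have hPP' : P' = P := congrArg (fun Q : HeightOnePrime S.toSubring => Q.1.asIdeal) hPP
  subst hPP'
  exact hxW (le_of_mem_affineModel hW' hx)

/-- A valuation ring that lies on `Y` is a localization of each member of `Y` contained in it. -/
theorem IsModel.mem_affineModel_of_le {R : Subring K} [IsNoetherianRing R]
    {Y : Set (LocalSubring K)} (hY : IsModel R Y) {S : LocalSubring K} (hS : S ∈ Y)
    {V : ValuationSubring K} (hV : V.toLocalSubring ∈ Y) (hSV : S.toSubring ≤ V.toSubring) :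
    V.toLocalSubring ∈ affineModel S.toSubring := by
  -- The centre T of V on S and V itself both belong to Y and are dominated by V; irredundance
  -- identifies them.
  obtain ⟨T, hT, hTV⟩ := exists_mem_affineModel_le (V := V.toLocalSubring) hSV
  rwa [← hY.irredundant V (hY.le hV) T (hY.mem_of_mem_affineModel hS hT) _ hV hTV le_rfl]

end Fiber

end ZariskiModel

/-! ### The main theorem -/

open ZariskiModel
theorem theorem3p10 {K : Type*} [Field K] (R : LocalSubring K)
    [IsFractionRing R.toSubring K] [IsRegularLocalRing R.toSubring]
    (hdim : 2 ≤ ringKrullDim R.toSubring)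
    (I : Ideal R.toSubring) (hI : I.radical = maximalIdeal R.toSubring)
    (hfin : (basePoints R I).Finite)
    (Y : Set (LocalSubring K)) (hY : IsCompleteModel R.toSubring Y) (hYn : IsNormalModel Y)
    (hg : HasMorphism (saturatedModel R (basePoints R I)) Y)
    (hh : HasMorphism Y (normalizedBlowup R.toSubring I))
    (hord : ∀ S ∈ basePoints R I,
      ∃ V ∈ reesValuationRings R.toSubring I, (V : Set K) = ordRing S) :
    (∀ S ∈ Y, ∀ T ∈ fiber (saturatedModel R (basePoints R I)) S,
      IsSublocalization S.toSubring T.toSubring) ∧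
    (∀ S ∈ Y, HasTorsionDivisorClassGroup S.toSubring →
      IsBiregularAt (saturatedModel R (basePoints R I)) S) ∧
    (∀ S ∈ Y, ¬ IsRegularLocalRing S.toSubring →
      ¬ HasTorsionDivisorClassGroup S.toSubring) := by
  have hI0 : I ≠ ⊥ := by
    rintro rfl
    have hm : maximalIdeal R.toSubring = ⊥ := by
      rw [← hI]
      exact Ideal.radical_bot_of_isReduced
    have h0 : ringKrullDim R.toSubring = 0 :=
      ringKrullDim_eq_zero_of_isField (isField_iff_maximalIdeal_eq.mpr hm)
    rw [h0] at hdim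
    exact absurd hdim (by norm_num)
  have hreg : ∀ S ∈ basePoints R I, IsRegularLocalRing S.toSubring := fun S hS => hS.1.regular
  have hrees : ∀ V ∈ reesValuationRings R.toSubring I,
      V.toLocalSubring ∈ Y ∧ IsDiscreteValuationRing V := fun V hV =>
    hY.mem_of_mem_reesValuationRings hYn hh hI0 hV
  have hregT : ∀ T ∈ saturatedModel R (basePoints R I), IsRegularLocalRing T.toSubring := by
    rintro T ⟨N, hN⟩
    exact isRegularLocalRing_of_mem_iterate hreg (hN N le_rfl)
  have hfrac : ∀ T ∈ saturatedModel R (basePoints R I), IsFractionRing T.toSubring K := by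
    rintro T ⟨N, hN⟩
    exact isFractionRing_of_le (le_of_mem_iterate_blowupPoints (hN N le_rfl))
  -- The heart of the proof: W comes from R, or is a Rees valuation ring and therefore a member of
  -- Y; in both cases it is a localization of S.
  have hess : ∀ S ∈ Y, ∀ T ∈ fiber (saturatedModel R (basePoints R I)) S,
      ∀ W ∈ affineModel T.toSubring, IsDiscreteValuationRing W.toSubring →
        W ∈ affineModel S.toSubring := by
    rintro S hS T ⟨⟨N, hN⟩, hST⟩ W hW hWd
    have hSW := hST.1.trans (le_of_mem_affineModel hW)
    rcases eq_or_mem_affineModel_of_mem_iterate (E := reesValuationRings R.toSubring I)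
      (fun S hS => (hord S hS).imp fun V hV => ⟨hV.1, (hrees V hV.1).2, hV.2⟩)
      (hN N le_rfl) hW hWd with h | ⟨V, hV, rfl⟩
    · exact mem_affineModel_of_le h (hY.le hS) hSW
    · exact hY.mem_affineModel_of_le hS (hrees V hV).1 hSW
  have hbireg : ∀ S ∈ Y, HasTorsionDivisorClassGroup S.toSubring →
      IsBiregularAt (saturatedModel R (basePoints R I)) S := by
    intro S hS htors
    have := hY.isNoetherianRing hS
    have := hYn S hS
    have : IsFractionRing S.toSubring K := isFractionRing_of_le (hY.le hS)
    have hsub : ∀ T ∈ fiber (saturatedModel R (basePoints R I)) S, T = S := by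
      intro T hT
      have := hregT T hT.1
      have := hfrac T hT.1
      have := isIntegrallyClosed_of_isRegularLocalRing (A := T.toSubring)
      exact eq_of_hasTorsionDivisorClassGroup hT.2 (hess S hS T hT) htors
    refine Set.eq_singleton_iff_unique_mem.mpr ⟨?_, hsub⟩
    -- The fibre is not empty: a valuation ring V dominating S has a centre on the complete model
    -- above, and the image of that centre in Y is S by irredundance.
    obtain ⟨V, hV⟩ := LocalSubring.exists_le_valuationSubring S
    have hRV : R.toSubring ≤ V.toSubring := (hY.le hS).trans hV.1
    obtain ⟨T, hT, hTV⟩ := exists_mem_saturatedModel_le hfin hreg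
      (fun S hS => hS.1.two_le_dim) hRV
    obtain ⟨S', hS', hST⟩ := hg T hT
    have hSS := hY.irredundant V hRV S' hS' S hS (hST.trans hTV) hV
    subst hSS
    have hmem : T ∈ fiber (saturatedModel R (basePoints R I)) S' := ⟨hT, hST⟩
    rwa [hsub T hmem] at hmem
  refine ⟨fun S hS T hT => ?_, hbireg, fun S hS hnreg htors => hnreg ?_⟩
  · have := hregT T hT.1
    have := hfrac T hT.1
    have := isIntegrallyClosed_of_isRegularLocalRing (A := T.toSubring)
    exact isSublocalization_of_forall_dvr (hess S hS T hT)
  -- Biregularity makes S itself a point of the regular model.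
  · have hmem : S ∈ fiber (saturatedModel R (basePoints R I)) S := by
      rw [hbireg S hS htors]
      rfl
    exact hregT S hmem.1
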